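/- Let $n\ge 2$ and $\sigma>0$. Let $\bar L\in\mathbb R^{n\times n}$ be lower triangular and $\bar b\in\mathbb R^n$ with $\max_{i,j}|\bar l_{ij}|\le 1$ and $\max_i|\bar b_i|\le 1$. Let $(L,b)\sim N_{\mathcal T}((\bar L,\bar b),\sigma^2\mathsf{Id})$, that is: $L$ is lower triangular, and the entries $l_{ij}$ ($j\le i$) and $b_i$ are independent with $l_{ij}\sim N(\bar l_{ij},\sigma^2)$ and $b_i\sim N(\bar b_i,\sigma^2)$. The system $Lx=b$ is solved by forward substitution, $$x_1=\frac{b_1}{l_{11}},\qquad x_i=\frac{b_i-(l_{i1}x_1+\cdots+l_{i,i-1}x_{i-1})}{l_{ii}}\quad(2\le i\le n),$$ where the inner sum of $i-1$ terms is evaluated along a balanced binary tree (of depth at most $\lceil\log_2(i-1)\rceil$), in finite precision with machine precision $\varepsilon_{\mathsf{mach}}$: every number $z$ that is read from the input or obtained by an arithmetic operation ($+,-,\times,/$) is replaced by a number $\tilde z$ with $|\tilde z-z|\le\varepsilon_{\mathsf{mach}}|z|$, where $\tilde z$ is a measurable function of the number read, respectively of the two operands. Let $\tilde x$ be the computed solution.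 Put $\mathsf{RelError}(x)=\max_{i\le n}|\tilde x_i-x_i|/|x_i|$ for $x=L^{-1}b$ (with $0/0=0$, and $a/0=\infty$ for $a>0$), and define the loss of precision, in decimal digits, by $$\mathsf{LoP}(x)=\log_{10}(\varepsilon_{\mathsf{mach}}^{-1})-\log_{10}(\mathsf{RelError}(x)^{-1})\in[-\infty,\infty],$$ with $\mathsf{LoP}(x)=\infty$ if $L$ is singular. Then for all sufficiently small $\varepsilon_{\mathsf{mach}}>0$ the expectation of $\mathsf{LoP}(x)$ is well defined in $[-\infty,\infty)$, and $$\mathbb E(\mathsf{LoP}(x))\le\log_{10}\Big(\frac{1+\sigma}{\sigma}\Big)+5\log_{10}n+\log_{10}(\log_2 n)+1.452+o(1),$$ where $o(1)$ is a quantity that depends only on $n$, $\sigma$ and $\varepsilon_{\mathsf{mach}}$ (not on $\bar L$, $\bar b$, the way of rounding, or the balanced trees) and tends to $0$ as $\varepsilon_{\mathsf{mach}}\to0$. -/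

import Mathlib

open MeasureTheory ProbabilityTheory Filter Topology
open scoped ENNReal NNReal Matrix

/-- A finite precision arithmetic with machine precision `ε`: reading a number and performing an
arithmetic operation both return a value whose relative error is at most `ε`
(so that an exact result `0` is returned exactly).  For a rounding map `rnd` the
instances are `read = rnd` (or the identity) and `add x y = rnd (x + y)`, and so on. -/
structure FinitePrecision (ε : ℝ) where
  read : ℝ → ℝ
  add : ℝ → ℝ → ℝ
  sub : ℝ → ℝ → ℝ
  mul : ℝ → ℝ → ℝ
  div : ℝ → ℝ → ℝ
  measurable_read : Measurable read
  measurable_add : Measurable (fun p : ℝ × ℝ => add p.1 p.2)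
  measurable_sub : Measurable (fun p : ℝ × ℝ => sub p.1 p.2)
  measurable_mul : Measurable (fun p : ℝ × ℝ => mul p.1 p.2)
  measurable_div : Measurable (fun p : ℝ × ℝ => div p.1 p.2)
  read_error : ∀ x, |read x - x| ≤ ε * |x|
  add_error : ∀ x y, |add x y - (x + y)| ≤ ε * |x + y|
  sub_error : ∀ x y, |sub x y - (x - y)| ≤ ε * |x - y|
  mul_error : ∀ x y, |mul x y - x * y| ≤ ε * |x * y|
  div_error : ∀ x y, y ≠ 0 → |div x y - x / y| ≤ ε * |x / y|

/-- The binary trees describing the order in which the terms of a sum are added. -/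
inductive SumTree (α : Type) : Type where
  | leaf : α → SumTree α
  | node : SumTree α → SumTree α → SumTree α

namespace SumTree

/-- The terms occurring in the sum, with multiplicity. -/
def leaves {α : Type} : SumTree α → Multiset α
  | leaf a => {a}
  | node s t => s.leaves + t.leaves

/-- The maximal number of additions that a term undergoes. -/
def depth {α : Type} : SumTree α → ℕ
  | leaf _ => 0
  | node s t => max s.depth t.depth + 1

/-- The sum of the terms `f a` along the tree, with the addition `add`. -/
def eval {α : Type} (add : ℝ → ℝ → ℝ) (f : α → ℝ) : SumTree α → ℝ
  | leaf a => f a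
  | node s t => add (s.eval add f) (t.eval add f)

end SumTree

/-- For each row `i` other than the first, a balanced tree along which
the `i` terms `l_{ij} x_j`, `j < i`, are added: each term is used once,
and the depth is at most `⌈log₂ i⌉` (rows are numbered from `0`). -/
structure SummationScheme (n : ℕ) where
  tree : ∀ i : Fin n, 0 < i.val → SumTree (Fin i.val)
  leaves_eq : ∀ (i : Fin n) (h : 0 < i.val), (tree i h).leaves = Finset.univ.val
  depth_le : ∀ (i : Fin n) (h : 0 < i.val), (tree i h).depth ≤ Nat.clog 2 i.val

/-- The solution of `L x = b` computed by forward substitution in finite precision: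
`x_i := (b_i - (l_{i0} x_0 + ⋯ + l_{i,i-1} x_{i-1})) / l_{ii}`, without the
subtraction in the first row. -/
noncomputable def forwardSubst {ε : ℝ} (M : FinitePrecision ε) {n : ℕ} (T : SummationScheme n)
    (L : Matrix (Fin n) (Fin n) ℝ) (b : Fin n → ℝ) (i : Fin n) : ℝ :=
  if h : 0 < i.val then
    M.div
      (M.sub (M.read (b i))
        ((T.tree i h).eval M.add fun j : Fin i.val =>
          M.mul (M.read (L i ⟨j.val, j.isLt.trans i.isLt⟩))
            (forwardSubst M T L b ⟨j.val, j.isLt.trans i.isLt⟩)))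
      (M.read (L i i))
  else M.div (M.read (b i)) (M.read (L i i))
termination_by i.val
decreasing_by exact j.isLt

/-- `|y - z| / |z|` for an approximation `y` of `z`; in `ℝ≥0∞` this is `0` for `y = z = 0`
and `∞` for `y ≠ z = 0`. -/
noncomputable def relError (y z : ℝ) : ℝ≥0∞ := ENNReal.ofReal |y - z| / ENNReal.ofReal |z|

/-- The componentwise relative error. -/
noncomputable def vecRelError {n : ℕ} (y z : Fin n → ℝ) : ℝ≥0∞ := ⨆ i, relError (y i) (z i)

/-- The decimal logarithm, with `log₁₀ 0 = -∞` and `log₁₀ ∞ = ∞`. -/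
noncomputable def log10 (t : ℝ≥0∞) : EReal := ENNReal.log t / ((Real.log 10 : ℝ) : EReal)

open Classical in
/-- The loss of precision in the solution of `L x = b` by forward substitution. -/
noncomputable def lossOfPrecision {ε : ℝ} (M : FinitePrecision ε) {n : ℕ} (T : SummationScheme n)
    (L : Matrix (Fin n) (Fin n) ℝ) (b : Fin n → ℝ) : EReal :=
  if L.det = 0 then ⊤
  else log10 (ENNReal.ofReal ε)⁻¹ -
    log10 (vecRelError (forwardSubst M T L b) (L⁻¹ *ᵥ b))⁻¹

/-- The law of a pair `(L, b)` with independent entries: `b i ∼ N(bbar i, σ²)`,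
`L i j ∼ N(Lbar i j, σ²)` for `j ≤ i`, and `L i j = Lbar i j` (which is `0`
for a lower triangular `Lbar`) for `i < j`. -/
noncomputable def smoothedTriangular {n : ℕ} (Lbar : Matrix (Fin n) (Fin n) ℝ) (bbar : Fin n → ℝ)
    (σ : ℝ) : Measure ((Fin n → Fin n → ℝ) × (Fin n → ℝ)) :=
  (Measure.pi fun i => Measure.pi fun j =>
      gaussianReal (Lbar i j) (if j ≤ i then (σ ^ 2).toNNReal else 0)).prod
    (Measure.pi fun i => gaussianReal (bbar i) (σ ^ 2).toNNReal)

/-- The expectation of an extended real function, the integral of its positive part minus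
the integral of its negative part; meaningful if one of the two is finite. -/
noncomputable def expectation {Ω : Type*} [MeasurableSpace Ω] (μ : Measure Ω) (f : Ω → EReal) :
    EReal :=
  ((∫⁻ ω, (f ω).toENNReal ∂μ : ℝ≥0∞) : EReal) - ((∫⁻ ω, (-f ω).toENNReal ∂μ : ℝ≥0∞) : EReal)

/-! Write `y_ij` for the entries of the inverse of `L`; column `j` is `fsolve L (Pi.single j 1)`.
The computed vector satisfies each row of the system up to a small relative residual, so applying
the inverse shows that the error in `x_i` is, to first order, at most `w ε` times the sum over `j ≤
i` of `|b_j y_ij|` and of all `|l_jk x_k y_ij|` with `k < j`. Here `w` is of the order of the depth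
of the summation trees (`forwardSubst_error`).

Now `x_i` is affine in `b_j` with slope `y_ij`, and affine in `l_jk` with slope `-x_k y_ij`. With
all other data frozen, each term divided by `|x_i|` therefore has the form `|a p| / |q + a p|` with
`a` Gaussian. Such a ratio has no bounded mean in general, but its moment of order `3/4` is at most
`6.12 κ^(3/4)` for `κ = (1 + σ) / σ`, whatever `p` and `q` are (`lintegral_ratio_le`). The power
`3/4` is subadditive and there are at most `n^3 / 2` terms over all `i`, so Jensen's inequality for
the logarithm bounds the mean of the logarithm of the first order part by `4/3 log (1 + w^(3/4) (n^3
/ 2) 6.12 κ^(3/4))`. The outer `4/3` turns `n^3` into `n^4`; the spare factor `n ≥ 2` up to `n^5`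
helps to pay for the constant `1.452` (`log_le_of_budget`).

The second order remainder is polynomial in the size `H` of the data and of the inverse diagonal,
divided by `|x_i|`. With `η = ε^(1/(6n+3))`, one factor `η` is attached to each factor that may be
large, and `log (1 + u) ≤ 2 √u` leaves only moments of order `1/2`, bounded in terms of `n` and `σ`.
The remainder thus contributes `O(√η)` for fixed `n` and `σ` (`forwardSubst_error_le_exp`,
`lossRemainder`). -/

/-! ### Exact forward substitution -/

/-- Forward substitution in exact arithmetic; only the entries `L i j` with `j ≤ i` are used. -/
noncomputable def fsolve {n : ℕ} (L : Fin n → Fin n → ℝ) (b : Fin n → ℝ) (i : Fin n) : ℝ :=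
  (b i - ∑ j : Fin i.val, L i ⟨j.val, j.isLt.trans i.isLt⟩ *
    fsolve L b ⟨j.val, j.isLt.trans i.isLt⟩) / L i i
termination_by i.val
decreasing_by exact j.isLt

theorem sum_fin_val_eq_sum_Iio {n : ℕ} (i : Fin n) (f : Fin n → ℝ) :
    ∑ j : Fin i.val, f ⟨j.val, j.isLt.trans i.isLt⟩ = ∑ j ∈ Finset.Iio i, f j := by
  refine Finset.sum_bij (fun j _ => ⟨j.val, j.isLt.trans i.isLt⟩) ?_ ?_ ?_ ?_
  · intro j _
    exact Finset.mem_Iio.2 j.isLt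
  · intro a _ b _ h
    exact Fin.ext (Fin.mk.inj_iff.1 h)
  · intro k hk
    exact ⟨⟨k.val, Fin.lt_def.1 (Finset.mem_Iio.1 hk)⟩, Finset.mem_univ _, rfl⟩
  · intros
    rfl

theorem fsolve_eq {n : ℕ} (L : Fin n → Fin n → ℝ) (b : Fin n → ℝ) (i : Fin n) :
    fsolve L b i = (b i - ∑ j ∈ Finset.Iio i, L i j * fsolve L b j) / L i i := by
  rw [fsolve, sum_fin_val_eq_sum_Iio i (fun j => L i j * fsolve L b j)]

theorem fin_strong_induction {n : ℕ} {P : Fin n → Prop}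
    (h : ∀ i, (∀ k, k < i → P k) → P i) (i : Fin n) : P i :=
  WellFounded.induction (C := P) (wellFounded_lt) i h

theorem fsolve_add_smul {n : ℕ} (L : Fin n → Fin n → ℝ) (b c : Fin n → ℝ) (t : ℝ) (i : Fin n) :
    fsolve L (b + t • c) i = fsolve L b i + t * fsolve L c i := by
  induction i using fin_strong_induction with
  | h i ih =>
    rw [fsolve_eq, fsolve_eq L b, fsolve_eq L c]
    rw [Finset.sum_congr rfl (fun k hk => by rw [ih k (Finset.mem_Iio.1 hk)])]
    simp only [mul_add, Finset.sum_add_distrib, Pi.add_apply, Pi.smul_apply, smul_eq_mul]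
    have : ∑ k ∈ Finset.Iio i, L i k * (t * fsolve L c k)
        = t * ∑ k ∈ Finset.Iio i, L i k * fsolve L c k := by
      rw [Finset.mul_sum]
      exact Finset.sum_congr rfl fun k _ => by ring
    rw [this]
    ring

/-- Forward substitution as a linear map in the right-hand side. -/
noncomputable def fsolveLinear {n : ℕ} (L : Fin n → Fin n → ℝ) :
    (Fin n → ℝ) →ₗ[ℝ] (Fin n → ℝ) where
  toFun := fsolve L
  map_add' b c := by
    ext i
    simpa using fsolve_add_smul L b c 1 i
  map_smul' t c := by
    have h0 : fsolve L 0 = 0 := by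
      ext i
      have := fsolve_add_smul L 0 0 1 i
      simp only [smul_zero, add_zero, one_mul] at this
      simpa using this
    ext i
    have := fsolve_add_smul L 0 c t i
    rw [h0] at this
    simpa using this

theorem fsolve_eq_sum {n : ℕ} (L : Fin n → Fin n → ℝ) (b : Fin n → ℝ) (i : Fin n) :
    fsolve L b i = ∑ j, b j * fsolve L (Pi.single j 1) i := by
  have h : b = ∑ j, b j • (Pi.single j 1 : Fin n → ℝ) := by
    ext k
    simp [Finset.sum_apply, Pi.single_apply]
  have h2 := congrArg (fun v => fsolveLinear L v i) h
  simp only [map_sum, map_smul, Finset.sum_apply, Pi.smul_apply, smul_eq_mul] at h2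
  exact h2

theorem fsolve_single_of_lt {n : ℕ} (L : Fin n → Fin n → ℝ) {i j : Fin n} (h : i < j) :
    fsolve L (Pi.single j 1) i = 0 := by
  induction i using fin_strong_induction with
  | h i ih =>
    rw [fsolve_eq, Finset.sum_eq_zero, Pi.single_eq_of_ne h.ne]
    · simp
    · intro k hk
      rw [ih k (Finset.mem_Iio.1 hk) ((Finset.mem_Iio.1 hk).trans h), mul_zero]

theorem fsolve_single_self {n : ℕ} (L : Fin n → Fin n → ℝ) (j : Fin n) :
    fsolve L (Pi.single j 1) j = 1 / L j j := by
  rw [fsolve_eq, Finset.sum_eq_zero, Pi.single_eq_same, sub_zero]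
  intro k hk
  rw [fsolve_single_of_lt L (Finset.mem_Iio.1 hk), mul_zero]

theorem fsolve_eq_sum_Iic {n : ℕ} (L : Fin n → Fin n → ℝ) (b : Fin n → ℝ) (i : Fin n) :
    fsolve L b i = ∑ j ∈ Finset.Iic i, b j * fsolve L (Pi.single j 1) i := by
  rw [fsolve_eq_sum]
  symm
  refine Finset.sum_subset (Finset.subset_univ _) fun j _ hj => ?_
  rw [fsolve_single_of_lt L (by simpa using hj), mul_zero]

theorem fsolve_unique {n : ℕ} {L : Fin n → Fin n → ℝ} (hL : ∀ i, L i i ≠ 0) {c z : Fin n → ℝ}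
    (h : ∀ i, L i i * z i + ∑ k ∈ Finset.Iio i, L i k * z k = c i) : z = fsolve L c := by
  ext i
  induction i using fin_strong_induction with
  | h i ih =>
    rw [fsolve_eq, ← h i, Finset.sum_congr rfl (fun k hk => by rw [ih k (Finset.mem_Iio.1 hk)])]
    field_simp [hL i]
    ring

theorem fsolve_spec {n : ℕ} {L : Fin n → Fin n → ℝ} (hL : ∀ i, L i i ≠ 0) (c : Fin n → ℝ)
    (i : Fin n) :
    L i i * fsolve L c i + ∑ k ∈ Finset.Iio i, L i k * fsolve L c k = c i := by
  rw [fsolve_eq L c i, mul_div_cancel₀ _ (hL i)]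
  ring

theorem fsolve_of_rhs_eq_off {n : ℕ} (L : Fin n → Fin n → ℝ) {b b' : Fin n → ℝ} {j : Fin n}
    (h : ∀ k, k ≠ j → b' k = b k) (i : Fin n) :
    fsolve L b' i = fsolve L b i + (b' j - b j) * fsolve L (Pi.single j 1) i := by
  rw [← fsolve_add_smul]
  congr 1
  ext k
  by_cases hk : k = j
  · subst hk
    simp
  · simp [h k hk, hk]

/-- The dependence of the solution on a single entry below the diagonal is affine. -/
theorem fsolve_of_entry_eq_off {n : ℕ} {L L' : Fin n → Fin n → ℝ} {j k : Fin n} (hkj : k < j)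
    (h : ∀ r s, ¬ (r = j ∧ s = k) → L' r s = L r s) (b : Fin n → ℝ) (i : Fin n) :
    fsolve L' b i = fsolve L b i -
      (L' j k - L j k) * fsolve L b k * fsolve L (Pi.single j 1) i := by
  induction i using fin_strong_induction with
  | h i ih =>
    have hd : L' i i = L i i := h i i (fun hh => by
      rw [hh.1] at hh
      exact hkj.ne' hh.2)
    rw [fsolve_eq L' b i, Finset.sum_congr rfl (fun m hm => by rw [ih m (Finset.mem_Iio.1 hm)]), hd]
    by_cases hij : i = j
    · subst hij
      rw [fsolve_single_self, fsolve_eq L b i]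
      have h1 : ∑ m ∈ Finset.Iio i, L' i m * (fsolve L b m -
          (L' i k - L i k) * fsolve L b k * fsolve L (Pi.single i 1) m)
          = ∑ m ∈ Finset.Iio i, (L i m * fsolve L b m +
            if m = k then (L' i k - L i k) * fsolve L b k else 0) := by
        refine Finset.sum_congr rfl fun m hm => ?_
        rw [fsolve_single_of_lt L (Finset.mem_Iio.1 hm)]
        split_ifs with hmk
        · subst hmk
          ring
        · rw [h i m (fun hh => hmk hh.2)]
          ring
      rw [h1, Finset.sum_add_distrib, Finset.sum_ite_eq', if_pos (Finset.mem_Iio.2 hkj)]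
      ring
    · rw [fsolve_eq L b i, fsolve_eq L (Pi.single j 1) i, Pi.single_eq_of_ne hij]
      have h1 : ∑ m ∈ Finset.Iio i, L' i m * (fsolve L b m -
          (L' j k - L j k) * fsolve L b k * fsolve L (Pi.single j 1) m)
          = ∑ m ∈ Finset.Iio i, L i m * fsolve L b m -
            (L' j k - L j k) * fsolve L b k *
              ∑ m ∈ Finset.Iio i, L i m * fsolve L (Pi.single j 1) m := by
        rw [Finset.mul_sum, ← Finset.sum_sub_distrib]
        refine Finset.sum_congr rfl fun m hm => ?_
        rw [h i m (fun hh => hij hh.1)]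
        ring
      rw [h1]
      ring

/-- The first columns of the solution do not depend on the entry `(j, k)` with `i < j`. -/
theorem fsolve_of_entry_eq_off_of_lt {n : ℕ} {L L' : Fin n → Fin n → ℝ} {i j k : Fin n}
    (hkj : k < j) (hij : i < j) (h : ∀ r s, ¬ (r = j ∧ s = k) → L' r s = L r s)
    (b : Fin n → ℝ) : fsolve L' b i = fsolve L b i := by
  rw [fsolve_of_entry_eq_off hkj h, fsolve_single_of_lt L hij]
  ring

/-- The change is proportional to component `k` of the solution for the unit vector at `j`, which
vanishes because `k < j`. Hence the slope of `x_i` in `l_jk` does not itself involve `l_jk`. -/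
theorem fsolve_single_of_entry_eq_off {n : ℕ} {L L' : Fin n → Fin n → ℝ} {j k : Fin n}
    (hkj : k < j) (h : ∀ r s, ¬ (r = j ∧ s = k) → L' r s = L r s) (i : Fin n) :
    fsolve L' (Pi.single j 1) i = fsolve L (Pi.single j 1) i := by
  rw [fsolve_of_entry_eq_off hkj h, fsolve_single_of_lt L hkj]
  ring

theorem det_ne_zero_of_lower {n : ℕ} {L : Fin n → Fin n → ℝ} (hlow : ∀ i j, i < j → L i j = 0)
    (hL : ∀ i, L i i ≠ 0) : (Matrix.of L).det ≠ 0 := by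
  rw [Matrix.det_of_isLowerTriangular (M := Matrix.of L) (fun i j hij => hlow i j hij)]
  exact Finset.prod_ne_zero_iff.2 fun i _ => hL i

theorem inv_mulVec_eq_fsolve {n : ℕ} {L : Fin n → Fin n → ℝ} (hlow : ∀ i j, i < j → L i j = 0)
    (hL : ∀ i, L i i ≠ 0) (b : Fin n → ℝ) :
    (Matrix.of L)⁻¹ *ᵥ b = fsolve L b := by
  have h : (Matrix.of L) *ᵥ fsolve L b = b := by
    ext i
    rw [← fsolve_spec hL b i]
    change ∑ k, L i k * fsolve L b k = _
    rw [Finset.add_sum_Iio_eq_sum_Iic (f := fun k => L i k * fsolve L b k)]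
    symm
    refine Finset.sum_subset (Finset.subset_univ _) fun j _ hj => ?_
    simp only [Finset.mem_Iic, not_le] at hj
    simp [hlow i j hj]
  conv_lhs => rw [← h]
  rw [Matrix.mulVec_mulVec, Matrix.nonsing_inv_mul _ (det_ne_zero_of_lower hlow hL).isUnit,
    Matrix.one_mulVec]

theorem measurable_fsolve {n : ℕ} {Ω : Type*} [MeasurableSpace Ω] {L : Ω → Fin n → Fin n → ℝ}
    {b : Ω → Fin n → ℝ} (hL : ∀ i j, Measurable fun ω => L ω i j)
    (hb : ∀ i, Measurable fun ω => b ω i) (i : Fin n) :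
    Measurable fun ω => fsolve (L ω) (b ω) i := by
  induction i using fin_strong_induction with
  | h i ih =>
    simp only [fun ω => fsolve_eq (L ω) (b ω) i]
    exact ((hb i).sub (Finset.measurable_sum _ fun k hk =>
      (hL i k).mul (ih k (Finset.mem_Iio.1 hk)))).div (hL i i)

/-! ### Rounding errors -/

/-- Each level of the tree costs one factor `1 + ε`. The second inequality is carried along because
the rounding error of a node is relative to its computed value, which must again be compared with
the sum of absolute values. -/
theorem SumTree.eval_error {ε : ℝ} (hε : 0 ≤ ε) (M : FinitePrecision ε) {α : Type} (f : α → ℝ)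
    (t : SumTree α) :
    |t.eval M.add f - (t.leaves.map f).sum| ≤
      ((1 + ε) ^ t.depth - 1) * (t.leaves.map fun a => |f a|).sum ∧
    |(t.leaves.map f).sum| ≤ (t.leaves.map fun a => |f a|).sum := by
  induction t with
  | leaf a => simp [SumTree.eval, SumTree.leaves, SumTree.depth]
  | node s t hs ht =>
    simp only [SumTree.eval, SumTree.leaves, SumTree.depth, Multiset.map_add, Multiset.sum_add]
    set S := (s.leaves.map f).sum
    set T := (t.leaves.map f).sum
    set A := (s.leaves.map fun a => |f a|).sum
    set B := (t.leaves.map fun a => |f a|).sum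
    set u := s.eval M.add f
    set v := t.eval M.add f
    have hA : 0 ≤ A := (abs_nonneg _).trans hs.2
    have hB : 0 ≤ B := (abs_nonneg _).trans ht.2
    have h1 : (1 + ε) ^ s.depth ≤ (1 + ε) ^ max s.depth t.depth :=
      pow_le_pow_right₀ (by linarith) (le_max_left _ _)
    have h2 : (1 + ε) ^ t.depth ≤ (1 + ε) ^ max s.depth t.depth :=
      pow_le_pow_right₀ (by linarith) (le_max_right _ _)
    rw [pow_succ]
    set p := (1 + ε) ^ max s.depth t.depth
    have h3 : |u - S| ≤ (p - 1) * A :=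
      hs.1.trans (mul_le_mul_of_nonneg_right (by linarith) hA)
    have h4 : |v - T| ≤ (p - 1) * B :=
      ht.1.trans (mul_le_mul_of_nonneg_right (by linarith) hB)
    refine ⟨?_, (abs_add_le _ _).trans (add_le_add hs.2 ht.2)⟩
    have h5 : |u + v - (S + T)| ≤ (p - 1) * (A + B) := by
      calc |u + v - (S + T)| = |(u - S) + (v - T)| := by ring_nf
        _ ≤ _ := (abs_add_le _ _).trans (by linarith)
    have h6 : |u + v| ≤ p * (A + B) := by
      calc |u + v| = |(u + v - (S + T)) + (S + T)| := by ring_nf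
        _ ≤ |u + v - (S + T)| + |S + T| := abs_add_le _ _
        _ ≤ (p - 1) * (A + B) + (A + B) :=
          add_le_add h5 ((abs_add_le _ _).trans (add_le_add hs.2 ht.2))
        _ = _ := by ring
    calc |M.add u v - (S + T)| = |(M.add u v - (u + v)) + (u + v - (S + T))| := by ring_nf
      _ ≤ |M.add u v - (u + v)| + |u + v - (S + T)| := abs_add_le _ _
      _ ≤ ε * (p * (A + B)) + (p - 1) * (A + B) :=
        add_le_add ((M.add_error u v).trans (mul_le_mul_of_nonneg_left h6 hε)) h5
      _ = _ := by ring

theorem FinitePrecision.read_ne_zero {ε : ℝ} (hε : ε < 1) (M : FinitePrecision ε) {x : ℝ}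
    (hx : x ≠ 0) : M.read x ≠ 0 := by
  intro h
  have h1 := M.read_error x
  rw [h, zero_sub, abs_neg] at h1
  nlinarith [abs_pos.2 hx]

theorem FinitePrecision.mul_read_error {ε : ℝ} (hε : 0 ≤ ε) (M : FinitePrecision ε) (x y : ℝ) :
    |M.mul (M.read x) y - x * y| ≤ ((1 + ε) ^ 2 - 1) * |x * y| := by
  have h1 := M.mul_error (M.read x) y
  have h2 : |M.read x * y - x * y| ≤ ε * |x * y| := by
    rw [← sub_mul, abs_mul, abs_mul, ← mul_assoc]
    exact mul_le_mul_of_nonneg_right (M.read_error x) (abs_nonneg _)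
  have h3 : |M.read x * y| ≤ (1 + ε) * |x * y| := by
    calc |M.read x * y| = |(M.read x * y - x * y) + x * y| := by ring_nf
      _ ≤ _ := (abs_add_le _ _).trans (by linarith)
  calc |M.mul (M.read x) y - x * y|
      = |(M.mul (M.read x) y - M.read x * y) + (M.read x * y - x * y)| := by ring_nf
    _ ≤ |M.mul (M.read x) y - M.read x * y| + |M.read x * y - x * y| := abs_add_le _ _
    _ ≤ ε * ((1 + ε) * |x * y|) + ε * |x * y| :=
      add_le_add (h1.trans (mul_le_mul_of_nonneg_left h3 hε)) h2
    _ = _ := by ring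

/-- A computed quotient by a number read from the input satisfies the linear equation up to a
relative error. -/
theorem FinitePrecision.div_read_residual {ε : ℝ} (hε1 : ε < 1)
    (M : FinitePrecision ε) (r : ℝ) {l : ℝ} (hl : l ≠ 0) :
    |l * M.div r (M.read l) - r| ≤ ε * |l * M.div r (M.read l)| + ε * |r| := by
  have h0 := M.read_ne_zero hε1 hl
  set z := M.div r (M.read l)
  have h1 : |M.read l * z - r| ≤ ε * |r| := by
    have := M.div_error r (M.read l) h0
    have h2 : M.read l * z - r = M.read l * (z - r / M.read l) := by
      field_simp
    rw [h2, abs_mul]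
    calc |M.read l| * |z - r / M.read l| ≤ |M.read l| * (ε * |r / M.read l|) :=
          mul_le_mul_of_nonneg_left this (abs_nonneg _)
      _ = ε * |r| := by
        rw [abs_div]
        have := abs_pos.2 h0
        field_simp
  have h3 : |l * z - M.read l * z| ≤ ε * |l * z| := by
    rw [← sub_mul, abs_mul, abs_mul, ← mul_assoc, abs_sub_comm]
    exact mul_le_mul_of_nonneg_right (M.read_error l) (abs_nonneg _)
  calc |l * z - r| = |(l * z - M.read l * z) + (M.read l * z - r)| := by ring_nf
    _ ≤ _ := (abs_add_le _ _).trans (add_le_add h3 h1)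

/-- The sum `∑ j < i, L i j * x̃ j` as computed along the tree. -/
theorem SummationScheme.eval_error {ε : ℝ} (hε : 0 ≤ ε) (M : FinitePrecision ε) {n : ℕ}
    (T : SummationScheme n) (i : Fin n) (h : 0 < i.val) (l z : Fin n → ℝ) :
    |((T.tree i h).eval M.add fun j : Fin i.val =>
          M.mul (M.read (l ⟨j.val, j.isLt.trans i.isLt⟩)) (z ⟨j.val, j.isLt.trans i.isLt⟩)) -
        ∑ k ∈ Finset.Iio i, l k * z k| ≤
      ((1 + ε) ^ (2 + Nat.clog 2 (n - 1)) - 1) * ∑ k ∈ Finset.Iio i, |l k * z k| := by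
  set f : Fin i.val → ℝ := fun j : Fin i.val =>
          M.mul (M.read (l ⟨j.val, j.isLt.trans i.isLt⟩)) (z ⟨j.val, j.isLt.trans i.isLt⟩)
  have h1 := (SumTree.eval_error hε M f (T.tree i h)).1
  rw [T.leaves_eq i h] at h1
  change |_ - ∑ j, f j| ≤ _ * ∑ j, |f j| at h1
  rw [← sum_fin_val_eq_sum_Iio i (fun k => l k * z k),
    ← sum_fin_val_eq_sum_Iio i (fun k => |l k * z k|)]
  set g : Fin i.val → ℝ := fun j => l ⟨j.val, j.isLt.trans i.isLt⟩ * z ⟨j.val, j.isLt.trans i.isLt⟩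
  change |_ - ∑ j, g j| ≤ _ * ∑ j, |g j|
  have hf : ∀ j, |f j - g j| ≤ ((1 + ε) ^ 2 - 1) * |g j| := fun j => M.mul_read_error hε _ _
  have h2 : |∑ j, f j - ∑ j, g j| ≤ ((1 + ε) ^ 2 - 1) * ∑ j, |g j| := by
    rw [← Finset.sum_sub_distrib, Finset.mul_sum]
    exact (Finset.abs_sum_le_sum_abs _ _).trans (Finset.sum_le_sum fun j _ => hf j)
  have h3 : ∑ j, |f j| ≤ (1 + ε) ^ 2 * ∑ j, |g j| := by
    rw [Finset.mul_sum]
    refine Finset.sum_le_sum fun j _ => ?_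
    calc |f j| = |(f j - g j) + g j| := by ring_nf
      _ ≤ |f j - g j| + |g j| := abs_add_le _ _
      _ ≤ _ := by linarith [hf j]
  -- Rows are numbered from `0`, so a row has at most `n - 1` terms.
  have hd : (1 + ε) ^ (T.tree i h).depth ≤ (1 + ε) ^ Nat.clog 2 (n - 1) :=
    pow_le_pow_right₀ (by linarith) ((T.depth_le i h).trans (Nat.clog_mono_right 2 (by omega)))
  have hp : 1 ≤ (1 + ε) ^ (T.tree i h).depth := one_le_pow₀ (by linarith)
  rw [pow_add]
  set p := (1 + ε) ^ Nat.clog 2 (n - 1)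
  have hG : 0 ≤ ∑ j, |g j| := Finset.sum_nonneg fun _ _ => abs_nonneg _
  have hF : 0 ≤ ∑ j, |f j| := Finset.sum_nonneg fun _ _ => abs_nonneg _
  calc _ = |((T.tree i h).eval M.add f - ∑ j, f j) + (∑ j, f j - ∑ j, g j)| := by ring_nf
    _ ≤ |(T.tree i h).eval M.add f - ∑ j, f j| + |∑ j, f j - ∑ j, g j| := abs_add_le _ _
    _ ≤ (p - 1) * ((1 + ε) ^ 2 * ∑ j, |g j|) + ((1 + ε) ^ 2 - 1) * ∑ j, |g j| := by
      refine add_le_add (h1.trans ?_) h2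
      exact mul_le_mul (by linarith) h3 hF (by linarith)
    _ = _ := by ring

/-- The residual of the solution computed by forward substitution. -/
theorem forwardSubst_residual {ε : ℝ} (hε : 0 ≤ ε) (hε1 : ε < 1) (M : FinitePrecision ε) {n : ℕ}
    (T : SummationScheme n) (L : Fin n → Fin n → ℝ) (b : Fin n → ℝ) (hL : ∀ i, L i i ≠ 0)
    (i : Fin n) :
    |L i i * forwardSubst M T (Matrix.of L) b i +
        ∑ k ∈ Finset.Iio i, L i k * forwardSubst M T (Matrix.of L) b k - b i| ≤
      ε * |L i i * forwardSubst M T (Matrix.of L) b i| +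
        ((1 + ε) ^ (4 + Nat.clog 2 (n - 1)) - 1) *
          (|b i| + ∑ k ∈ Finset.Iio i, |L i k * forwardSubst M T (Matrix.of L) b k|) := by
  have hb := M.read_error (b i)
  have hb' : |M.read (b i)| ≤ (1 + ε) * |b i| := by
    calc |M.read (b i)| = |(M.read (b i) - b i) + b i| := by ring_nf
      _ ≤ _ := (abs_add_le _ _).trans (by linarith)
  have hpow : 1 ≤ (1 + ε) ^ (2 + Nat.clog 2 (n - 1)) := one_le_pow₀ (by linarith)
  have hpow2 : (1 + ε) ≤ (1 + ε) ^ (2 + Nat.clog 2 (n - 1)) :=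
    le_self_pow₀ (by linarith) (by omega)
  -- The exponent counts roundings: two for reading an entry and multiplying, `Nat.clog 2 (n - 1)`
  -- for the tree, one for the subtraction and one for the division. The rounding of the diagonal
  -- entry is kept apart as `ε * |L i i * x i|`.
  have hsplit : (1 + ε) ^ (4 + Nat.clog 2 (n - 1))
      = (1 + ε) ^ (2 + Nat.clog 2 (n - 1)) * (1 + ε) ^ 2 := by
    rw [← pow_add]
    congr 1
    omega
  rw [hsplit]
  set p := (1 + ε) ^ (2 + Nat.clog 2 (n - 1))
  by_cases h : 0 < i.val
  · set x := forwardSubst M T (Matrix.of L) b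
    set S := ((T.tree i h).eval M.add fun j : Fin i.val =>
          M.mul (M.read (L i ⟨j.val, j.isLt.trans i.isLt⟩)) (x ⟨j.val, j.isLt.trans i.isLt⟩))
    have hx : x i = M.div (M.sub (M.read (b i)) S) (M.read (L i i)) := by
      simp only [x, S]
      rw [forwardSubst, dif_pos h]
      rfl
    have hS := T.eval_error hε M i h (L i) x
    change |S - _| ≤ (p - 1) * _ at hS
    set r := M.sub (M.read (b i)) S
    have h1 := M.div_read_residual hε1 r (hL i)
    rw [← hx] at h1
    have h2 : |r - (M.read (b i) - S)| ≤ ε * |M.read (b i) - S| := M.sub_error _ _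
    set A := ∑ k ∈ Finset.Iio i, L i k * x k
    set B := ∑ k ∈ Finset.Iio i, |L i k * x k|
    have hAB : |A| ≤ B := Finset.abs_sum_le_sum_abs _ _
    have hB : 0 ≤ B := (abs_nonneg _).trans hAB
    have h3 : |M.read (b i) - S - (b i - A)| ≤ (p - 1) * (|b i| + B) := by
      calc |M.read (b i) - S - (b i - A)| = |(M.read (b i) - b i) - (S - A)| := by ring_nf
        _ ≤ |M.read (b i) - b i| + |S - A| := abs_sub _ _
        _ ≤ ε * |b i| + (p - 1) * B := add_le_add hb hS
        _ ≤ (p - 1) * |b i| + (p - 1) * B := by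
          gcongr
          linarith
        _ = _ := by ring
    have h4 : |M.read (b i) - S| ≤ p * (|b i| + B) := by
      calc |M.read (b i) - S| = |(M.read (b i) - S - (b i - A)) + (b i - A)| := by ring_nf
        _ ≤ |M.read (b i) - S - (b i - A)| + |b i - A| := abs_add_le _ _
        _ ≤ (p - 1) * (|b i| + B) + (|b i| + B) :=
          add_le_add h3 ((abs_sub _ _).trans (by linarith))
        _ = _ := by ring
    have h5 : |r - (b i - A)| ≤ (p * (1 + ε) - 1) * (|b i| + B) := by
      calc |r - (b i - A)|
          = |(r - (M.read (b i) - S)) + (M.read (b i) - S - (b i - A))| := by ring_nf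
        _ ≤ |r - (M.read (b i) - S)| + |M.read (b i) - S - (b i - A)| := abs_add_le _ _
        _ ≤ ε * (p * (|b i| + B)) + (p - 1) * (|b i| + B) :=
          add_le_add (h2.trans (mul_le_mul_of_nonneg_left h4 hε)) h3
        _ = _ := by ring
    have h6 : |r| ≤ p * (1 + ε) * (|b i| + B) := by
      calc |r| = |(r - (b i - A)) + (b i - A)| := by ring_nf
        _ ≤ |r - (b i - A)| + |b i - A| := abs_add_le _ _
        _ ≤ (p * (1 + ε) - 1) * (|b i| + B) + (|b i| + B) :=
          add_le_add h5 ((abs_sub _ _).trans (by linarith))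
        _ = _ := by ring
    calc |L i i * x i + A - b i| = |(L i i * x i - r) + (r - (b i - A))| := by ring_nf
      _ ≤ |L i i * x i - r| + |r - (b i - A)| := abs_add_le _ _
      _ ≤ (ε * |L i i * x i| + ε * (p * (1 + ε) * (|b i| + B))) +
          (p * (1 + ε) - 1) * (|b i| + B) :=
        add_le_add (h1.trans (by gcongr)) h5
      _ = _ := by ring
  · have hx : forwardSubst M T (Matrix.of L) b i = M.div (M.read (b i)) (M.read (L i i)) := by
      rw [forwardSubst, dif_neg h]
      rfl
    have h0 : Finset.Iio i = ∅ := by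
      ext k
      simp only [Finset.mem_Iio, Finset.notMem_empty, iff_false, not_lt, Fin.le_def]
      omega
    have h1 := M.div_read_residual hε1 (M.read (b i)) (hL i)
    rw [← hx] at h1
    rw [h0, Finset.sum_empty, Finset.sum_empty, add_zero, add_zero]
    set z := forwardSubst M T (Matrix.of L) b i
    calc |L i i * z - b i| = |(L i i * z - M.read (b i)) + (M.read (b i) - b i)| := by ring_nf
      _ ≤ |L i i * z - M.read (b i)| + |M.read (b i) - b i| := abs_add_le _ _
      _ ≤ (ε * |L i i * z| + ε * ((1 + ε) * |b i|)) + ε * |b i| :=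
        add_le_add (h1.trans (by gcongr)) hb
      _ = ε * |L i i * z| + (1 * (1 + ε) ^ 2 - 1) * |b i| := by ring
      _ ≤ _ := by gcongr

/-! ### Propagation of the errors -/

/-- A discrete Gronwall inequality: the bound grows by a factor `2 * Q` per row, since `A` is at
most the bound already reached. -/
theorem growth_bound {n : ℕ} {u : Fin n → ℝ} {A Q : ℝ} (hA : 0 ≤ A) (hQ : 1 ≤ Q)
    (h : ∀ i K, 0 ≤ K → (∀ k, k < i → u k ≤ K) → u i ≤ Q * (A + K)) (i : Fin n) :
    u i ≤ A * (2 * Q) ^ n := by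
  have key : ∀ i : Fin n, u i ≤ A * (2 * Q) ^ (i.val + 1) := by
    intro i
    induction i using fin_strong_induction with
    | h i ih =>
      have h1 : u i ≤ Q * (A + A * (2 * Q) ^ i.val) := by
        refine h i _ (by positivity) fun k hk => (ih k hk).trans ?_
        gcongr
        · linarith
        · exact hk
      have h2 : (1 : ℝ) ≤ (2 * Q) ^ i.val := one_le_pow₀ (by linarith)
      calc u i ≤ Q * (A + A * (2 * Q) ^ i.val) := h1
        _ ≤ Q * (A * (2 * Q) ^ i.val + A * (2 * Q) ^ i.val) := by
          gcongr
          nlinarith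
        _ = _ := by ring
  refine (key i).trans ?_
  gcongr
  · linarith
  · exact i.isLt

/-- The forward error of the solution computed by forward substitution: a main term of first order
in the precision and a crude bound for the remainder. -/
theorem forwardSubst_error {ε : ℝ} (hε : 0 ≤ ε) (M : FinitePrecision ε) {n : ℕ}
    (T : SummationScheme n) (L : Fin n → Fin n → ℝ) (b : Fin n → ℝ) (hL : ∀ i, L i i ≠ 0)
    {g : ℝ} (hg : (1 + ε) ^ (4 + Nat.clog 2 (n - 1)) - 1 ≤ g) (hg2 : g ≤ 1 / 2)
    {H : ℝ} (hH : 1 ≤ H) (hb : ∀ i, |b i| ≤ H) (hrow : ∀ i, ∑ k ∈ Finset.Iic i, |L i k| ≤ H)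
    (hinv : ∀ i, |L i i|⁻¹ ≤ H) (i : Fin n) :
    |forwardSubst M T (Matrix.of L) b i - fsolve L b i| ≤
      (ε + g) * (∑ j ∈ Finset.Iic i, (|b j * fsolve L (Pi.single j 1) i| +
        ∑ k ∈ Finset.Iio j, |L j k * fsolve L b k * fsolve L (Pi.single j 1) i|)) +
      g * (ε + g) * (n * H * ((8 * H ^ 2) ^ n) ^ 3) := by
  have hεg : ε ≤ g := by
    refine le_trans ?_ hg
    have : (1 + ε) ≤ (1 + ε) ^ (4 + Nat.clog 2 (n - 1)) := le_self_pow₀ (by linarith) (by omega)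
    linarith
  have hg0 : 0 ≤ g := hε.trans hεg
  have hε1 : ε < 1 := by linarith
  set x := fsolve L b
  set z := forwardSubst M T (Matrix.of L) b
  set ρ : Fin n → ℝ := fun i => L i i * z i + ∑ k ∈ Finset.Iio i, L i k * z k - b i
  set X := (8 * H ^ 2) ^ n
  have hX1 : 1 ≤ X := one_le_pow₀ (by nlinarith)
  have hres : ∀ i, |ρ i| ≤ ε * |L i i * z i| +
      g * (|b i| + ∑ k ∈ Finset.Iio i, |L i k * z k|) := fun i =>
    (forwardSubst_residual hε hε1 M T L b hL i).trans (by gcongr)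
  -- The error vector solves the triangular system with the residual `ρ` as right-hand side.
  have he : ∀ i, L i i * (z i - x i) + ∑ k ∈ Finset.Iio i, L i k * (z k - x k) = ρ i := by
    intro i
    have h1 := fsolve_spec hL b i
    change L i i * x i + ∑ k ∈ Finset.Iio i, L i k * x k = b i at h1
    simp only [mul_sub, Finset.sum_sub_distrib, ρ]
    linarith
  have hesolve : ∀ i, z i - x i = fsolve L ρ i := fun i =>
    congrFun (fsolve_unique (z := fun i => z i - x i) hL he) i
  have hdiag : ∀ (i : Fin n) (t : ℝ), |t| ≤ H * |L i i * t| := by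
    intro i t
    have h0 := abs_pos.2 (hL i)
    rw [abs_mul, ← mul_assoc]
    have : 1 ≤ H * |L i i| := by
      have := mul_le_mul_of_nonneg_right (hinv i) h0.le
      rwa [inv_mul_cancel₀ h0.ne'] at this
    nlinarith [abs_nonneg t]
  have hdiagH : ∀ i, |L i i| ≤ H := fun i =>
    (Finset.single_le_sum (f := fun k => |L i k|) (fun _ _ => abs_nonneg _)
      (Finset.mem_Iic.2 le_rfl)).trans (hrow i)
  have hsum : ∀ (i : Fin n) (u : Fin n → ℝ) (K : ℝ), 0 ≤ K → (∀ k, k < i → |u k| ≤ K) →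
      ∑ k ∈ Finset.Iio i, |L i k * u k| ≤ H * K := by
    intro i u K hK hu
    calc ∑ k ∈ Finset.Iio i, |L i k * u k| ≤ ∑ k ∈ Finset.Iio i, |L i k| * K := by
          refine Finset.sum_le_sum fun k hk => ?_
          rw [abs_mul]
          exact mul_le_mul_of_nonneg_left (hu k (Finset.mem_Iio.1 hk)) (abs_nonneg _)
      _ = (∑ k ∈ Finset.Iio i, |L i k|) * K := by rw [Finset.sum_mul]
      _ ≤ (∑ k ∈ Finset.Iic i, |L i k|) * K := by
        refine mul_le_mul_of_nonneg_right (Finset.sum_le_sum_of_subset_of_nonneg ?_ ?_) hK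
        · exact fun k hk => Finset.mem_Iic.2 (Finset.mem_Iio.1 hk).le
        · exact fun _ _ _ => abs_nonneg _
      _ ≤ H * K := mul_le_mul_of_nonneg_right (hrow i) hK
  have hsolve : ∀ c : Fin n → ℝ, (∀ i, |c i| ≤ H) → ∀ i, |fsolve L c i| ≤ X := by
    intro c hc i
    have := growth_bound (u := fun i => |fsolve L c i|) (A := 1) (Q := 4 * H ^ 2) zero_le_one
      (by nlinarith) (fun i K hK hk => ?_) i
    · calc |fsolve L c i| ≤ 1 * (2 * (4 * H ^ 2)) ^ n := this
        _ = X := by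
          simp only [X]
          ring
    · have h1 := hsum i (fsolve L c) K hK hk
      have h2 : |L i i * fsolve L c i| ≤ H + H * K := by
        have h3 : L i i * fsolve L c i = c i - ∑ k ∈ Finset.Iio i, L i k * fsolve L c k := by
          linarith [fsolve_spec hL c i]
        rw [h3]
        exact (abs_sub _ _).trans (add_le_add (hc i)
          ((Finset.abs_sum_le_sum_abs _ _).trans h1))
      calc |fsolve L c i| ≤ H * |L i i * fsolve L c i| := hdiag i _
        _ ≤ H * (H + H * K) := by gcongr
        _ = 1 * (H ^ 2 * (1 + K)) := by ring
        _ ≤ 4 * (H ^ 2 * (1 + K)) := by gcongr; norm_num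
        _ = 4 * H ^ 2 * (1 + K) := by ring
  have hx : ∀ i, |x i| ≤ X := hsolve b hb
  have hy : ∀ j i, |fsolve L (Pi.single j 1) i| ≤ X := fun j => hsolve _ fun i => by
    by_cases hij : i = j
    · subst hij
      simpa using hH
    · rw [Pi.single_eq_of_ne hij]
      simp
      linarith
  have hxz : ∀ i k, |L i k * z k| ≤ |L i k * x k| + |L i k * (z k - x k)| := fun i k => by
    calc |L i k * z k| = |L i k * x k + L i k * (z k - x k)| := by ring_nf
      _ ≤ _ := abs_add_le _ _
  -- The computed `z` is replaced by `x + (z - x)`. Row `i` of the exact system bounds `|L i i * x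
  -- i|` by the other terms of the row, so diagonal entries need no sensitivity term of their own.
  have hρ : ∀ i, |ρ i| ≤ (ε + g) * (|b i| + ∑ k ∈ Finset.Iio i, |L i k * x k|) +
      g * (|L i i * (z i - x i)| + ∑ k ∈ Finset.Iio i, |L i k * (z k - x k)|) := by
    intro i
    have h1 : |L i i * x i| ≤ |b i| + ∑ k ∈ Finset.Iio i, |L i k * x k| := by
      have h3 : L i i * x i = b i - ∑ k ∈ Finset.Iio i, L i k * x k := by
        linarith [fsolve_spec hL b i]
      rw [h3]
      exact (abs_sub _ _).trans (add_le_add le_rfl (Finset.abs_sum_le_sum_abs _ _))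
    have h2 : ∑ k ∈ Finset.Iio i, |L i k * z k| ≤ ∑ k ∈ Finset.Iio i, |L i k * x k| +
        ∑ k ∈ Finset.Iio i, |L i k * (z k - x k)| := by
      rw [← Finset.sum_add_distrib]
      exact Finset.sum_le_sum fun k _ => hxz i k
    have h3 := hxz i i
    have h4 := abs_nonneg (L i i * (z i - x i))
    calc |ρ i| ≤ ε * |L i i * z i| + g * (|b i| + ∑ k ∈ Finset.Iio i, |L i k * z k|) := hres i
      _ ≤ ε * ((|b i| + ∑ k ∈ Finset.Iio i, |L i k * x k|) + |L i i * (z i - x i)|) +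
          g * (|b i| + (∑ k ∈ Finset.Iio i, |L i k * x k| +
            ∑ k ∈ Finset.Iio i, |L i k * (z k - x k)|)) := by
        gcongr
        linarith
      _ = (ε + g) * (|b i| + ∑ k ∈ Finset.Iio i, |L i k * x k|) +
          (ε * |L i i * (z i - x i)| + g * ∑ k ∈ Finset.Iio i, |L i k * (z k - x k)|) := by ring
      _ ≤ (ε + g) * (|b i| + ∑ k ∈ Finset.Iio i, |L i k * x k|) +
          (g * |L i i * (z i - x i)| + g * ∑ k ∈ Finset.Iio i, |L i k * (z k - x k)|) := by
        gcongr
      _ = _ := by ring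
  have hemax : ∀ i, |z i - x i| ≤ (ε + g) * X * X := by
    intro i
    have := growth_bound (u := fun i => |z i - x i|) (A := (ε + g) * X) (Q := 4 * H ^ 2)
      (by positivity) (by nlinarith) (fun i K hK hk => ?_) i
    · calc |z i - x i| ≤ (ε + g) * X * (2 * (4 * H ^ 2)) ^ n := this
        _ = (ε + g) * X * X := by
          simp only [X]
          ring
    · have h1 := hsum i (fun k => z k - x k) K hK hk
      have h2 := hsum i x X (by linarith) (fun k _ => hx k)
      have h3 := hρ i
      have h4 : |L i i * (z i - x i)| ≤ |ρ i| + H * K := by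
        have : L i i * (z i - x i) = ρ i - ∑ k ∈ Finset.Iio i, L i k * (z k - x k) := by
          linarith [he i]
        rw [this]
        exact (abs_sub _ _).trans (add_le_add le_rfl ((Finset.abs_sum_le_sum_abs _ _).trans h1))
      set D := |L i i * (z i - x i)|
      have hD : 0 ≤ D := abs_nonneg _
      have h5 : |ρ i| ≤ (ε + g) * (H * X + H * X) + (1 / 2 * D + 1 / 2 * (H * K)) := by
        refine h3.trans ?_
        have e1 : |b i| ≤ H * X := (hb i).trans (by nlinarith)
        have e2 : g * (D + ∑ k ∈ Finset.Iio i, |L i k * (z k - x k)|) ≤ 1 / 2 * (D + H * K) := by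
          gcongr
        have e3 : (ε + g) * (|b i| + ∑ k ∈ Finset.Iio i, |L i k * x k|) ≤
            (ε + g) * (H * X + H * X) := by gcongr
        linarith
      -- The hypothesis `g ≤ 1 / 2` allows the term `1 / 2 * D` to be absorbed on the left.
      have h6 : D ≤ 4 * (H * ((ε + g) * X + K)) := by nlinarith
      calc |z i - x i| ≤ H * D := hdiag i _
        _ ≤ H * (4 * (H * ((ε + g) * X + K))) := by gcongr
        _ = 4 * H ^ 2 * ((ε + g) * X + K) := by ring
  rw [hesolve, fsolve_eq_sum_Iic]
  have hrow2 : ∀ j, |L j j * (z j - x j)| + ∑ k ∈ Finset.Iio j, |L j k * (z k - x k)| ≤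
      H * ((ε + g) * X * X) := by
    intro j
    calc _ = ∑ k ∈ Finset.Iic j, |L j k * (z k - x k)| := by
          rw [← Finset.add_sum_Iio_eq_sum_Iic (f := fun k => |L j k * (z k - x k)|)]
      _ ≤ ∑ k ∈ Finset.Iic j, |L j k| * ((ε + g) * X * X) := by
        refine Finset.sum_le_sum fun k _ => ?_
        rw [abs_mul]
        exact mul_le_mul_of_nonneg_left (hemax k) (abs_nonneg _)
      _ = (∑ k ∈ Finset.Iic j, |L j k|) * ((ε + g) * X * X) := by rw [Finset.sum_mul]
      _ ≤ _ := mul_le_mul_of_nonneg_right (hrow j) (by positivity)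
  calc |∑ j ∈ Finset.Iic i, ρ j * fsolve L (Pi.single j 1) i|
      ≤ ∑ j ∈ Finset.Iic i, |ρ j * fsolve L (Pi.single j 1) i| := Finset.abs_sum_le_sum_abs _ _
    _ ≤ ∑ j ∈ Finset.Iic i, ((ε + g) * (|b j * fsolve L (Pi.single j 1) i| +
        ∑ k ∈ Finset.Iio j, |L j k * x k * fsolve L (Pi.single j 1) i|) +
          g * (H * ((ε + g) * X * X)) * X) := by
      refine Finset.sum_le_sum fun j _ => ?_
      rw [abs_mul, abs_mul]
      simp only [abs_mul _ (fsolve L (Pi.single j 1) i), ← Finset.sum_mul]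
      have h1 : |ρ j| ≤ (ε + g) * (|b j| + ∑ k ∈ Finset.Iio j, |L j k * x k|) +
          g * (H * ((ε + g) * X * X)) := (hρ j).trans (by gcongr; exact hrow2 j)
      calc |ρ j| * |fsolve L (Pi.single j 1) i|
          ≤ ((ε + g) * (|b j| + ∑ k ∈ Finset.Iio j, |L j k * x k|) +
          g * (H * ((ε + g) * X * X))) * |fsolve L (Pi.single j 1) i| := by gcongr
        _ = (ε + g) * (|b j| * |fsolve L (Pi.single j 1) i| +
            (∑ k ∈ Finset.Iio j, |L j k * x k|) * |fsolve L (Pi.single j 1) i|) +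
            g * (H * ((ε + g) * X * X)) * |fsolve L (Pi.single j 1) i| := by ring
        _ ≤ _ := by
          gcongr
          exact hy j i
    _ = (ε + g) * (∑ j ∈ Finset.Iic i, (|b j * fsolve L (Pi.single j 1) i| +
        ∑ k ∈ Finset.Iio j, |L j k * x k * fsolve L (Pi.single j 1) i|)) +
        (Finset.Iic i).card * (g * (H * ((ε + g) * X * X)) * X) := by
      rw [Finset.sum_add_distrib, ← Finset.mul_sum, Finset.sum_const, nsmul_eq_mul]
    _ ≤ (ε + g) * (∑ j ∈ Finset.Iic i, (|b j * fsolve L (Pi.single j 1) i| +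
        ∑ k ∈ Finset.Iio j, |L j k * x k * fsolve L (Pi.single j 1) i|)) +
        n * (g * (H * ((ε + g) * X * X)) * X) := by
      gcongr
      exact (Finset.card_le_univ _).trans_eq (Fintype.card_fin n)
    _ = _ := by ring

/-! ### Integrals over products of probability measures -/

/-- Fubini: a bound for the integral over one coordinate, uniform in the frozen ones, survives
averaging over them. This is what lets one Gaussian entry be treated at a time. -/
theorem lintegral_pi_le_of_forall_update {ι : Type*} [Fintype ι] [DecidableEq ι] {X : ι → Type*}
    [∀ i, MeasurableSpace (X i)] (μ : ∀ i, Measure (X i)) [∀ i, IsProbabilityMeasure (μ i)]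
    {f : (∀ i, X i) → ℝ≥0∞} (hf : Measurable f) (j : ι) {B : ℝ≥0∞}
    (h : ∀ x, ∫⁻ y, f (Function.update x j y) ∂μ j ≤ B) : ∫⁻ x, f x ∂Measure.pi μ ≤ B := by
  obtain ⟨x⟩ : Nonempty (∀ i, X i) := (Measure.pi μ).nonempty_of_neZero
  rw [lintegral_eq_lmarginal_univ x, lmarginal_erase' f hf (Finset.mem_univ j)]
  refine (lmarginal_mono (g := fun _ => B) (fun x => h x) x).trans ?_
  simp [lmarginal]

/-! ### Moments of Gaussian variables -/

/-- Used for the remainder: moments of order `1 / 2` exist even for inverses of Gaussian variables.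
-/
theorem log_one_add_le_two_mul_sqrt {u : ℝ} (hu : 0 ≤ u) : Real.log (1 + u) ≤ 2 * √u := by
  have h0 := Real.sqrt_nonneg u
  have h1 : 1 + u ≤ (1 + √u) ^ 2 := by nlinarith [Real.sq_sqrt hu]
  calc Real.log (1 + u) ≤ Real.log ((1 + √u) ^ 2) := Real.log_le_log (by linarith) h1
    _ = 2 * Real.log (1 + √u) := by
      rw [Real.log_pow]
      norm_num
    _ ≤ 2 * √u := by
      have := Real.log_le_sub_one_of_pos (show 0 < 1 + √u by linarith)
      linarith

theorem lintegral_indicator_rpow_neg_le {β r : ℝ} (hβ1 : β < 1) (hr : 0 ≤ r)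
    (c : ℝ) :
    ∫⁻ x, {x : ℝ | |x + c| ≤ r}.indicator (fun x => ENNReal.ofReal (|x + c| ^ (-β))) x ≤
      ENNReal.ofReal (2 * (r ^ (1 - β) / (1 - β))) := by
  set G : ℝ → ℝ≥0∞ := (Set.Icc 0 r).indicator fun x => ENNReal.ofReal (x ^ (-β))
  have hG : Measurable G :=
    (ENNReal.measurable_ofReal.comp (measurable_id.pow_const (-β))).indicator measurableSet_Icc
  have hint : ∫⁻ x, G x = ENNReal.ofReal (r ^ (1 - β) / (1 - β)) := by
    simp only [G]
    rw [lintegral_indicator measurableSet_Icc, setLIntegral_congr Ioc_ae_eq_Icc.symm,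
      ← ofReal_integral_eq_lintegral_ofReal, ← intervalIntegral.integral_of_le hr,
      integral_rpow (Or.inl (by linarith)), Real.zero_rpow (by linarith), sub_zero]
    · ring_nf
    · exact (intervalIntegrable_iff_integrableOn_Ioc_of_le hr).1
        (intervalIntegral.intervalIntegrable_rpow' (by linarith))
    · exact (ae_restrict_iff' measurableSet_Ioc).2
        (ae_of_all _ fun x hx => Real.rpow_nonneg hx.1.le _)
  have hle : ∀ y : ℝ, {x : ℝ | |x| ≤ r}.indicator (fun x => ENNReal.ofReal (|x| ^ (-β))) y ≤
      G y + G (-y) := by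
    intro y
    by_cases hy : |y| ≤ r
    · rw [Set.indicator_of_mem (by exact hy)]
      rcases le_total 0 y with h | h
      · rw [abs_of_nonneg h] at hy ⊢
        simp only [G]
        rw [Set.indicator_of_mem (by exact ⟨h, hy⟩)]
        exact le_self_add
      · rw [abs_of_nonpos h] at hy ⊢
        simp only [G]
        rw [Set.indicator_of_mem (show -y ∈ Set.Icc 0 r from ⟨by linarith, hy⟩)]
        exact le_add_self
    · rw [Set.indicator_of_notMem (by exact hy)]
      exact zero_le
  calc _ = ∫⁻ x, {x : ℝ | |x| ≤ r}.indicator (fun x => ENNReal.ofReal (|x| ^ (-β))) (x + c) := rfl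
    _ = ∫⁻ x, {x : ℝ | |x| ≤ r}.indicator (fun x => ENNReal.ofReal (|x| ^ (-β))) x :=
      lintegral_add_right_eq_self _ c
    _ ≤ ∫⁻ x, (G x + G (-x)) := lintegral_mono hle
    _ = (∫⁻ x, G x) + ∫⁻ x, G (-x) := lintegral_add_left hG _
    _ = ENNReal.ofReal (r ^ (1 - β) / (1 - β)) + ENNReal.ofReal (r ^ (1 - β) / (1 - β)) := by
      rw [lintegral_neg_eq_self (μ := volume) G, hint]
    _ = _ := by
      have : 0 ≤ r ^ (1 - β) / (1 - β) := div_nonneg (Real.rpow_nonneg hr _) (by linarith)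
      rw [← ENNReal.ofReal_add this this]
      ring_nf

theorem lintegral_gaussianReal {μ : ℝ} {v : ℝ≥0} (hv : v ≠ 0) {f : ℝ → ℝ≥0∞} (hf : Measurable f) :
    ∫⁻ a, f a ∂gaussianReal μ v = ∫⁻ a, gaussianPDF μ v a * f a := by
  rw [gaussianReal_of_var_ne_zero μ hv,
    lintegral_withDensity_eq_lintegral_mul _ (measurable_gaussianPDF μ v) hf]
  rfl

theorem toNNReal_sq_ne_zero {σ : ℝ} (hσ : 0 < σ) : (σ ^ 2).toNNReal ≠ 0 := by
  simpa using hσ.ne'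

theorem gaussianPDFReal_eq_exp {σ : ℝ} (hσ : 0 < σ) (μ a : ℝ) :
    gaussianPDFReal μ (σ ^ 2).toNNReal a =
      (σ * √(2 * Real.pi))⁻¹ * Real.exp (-(((a - μ) / σ) ^ 2 / 2)) := by
  rw [gaussianPDFReal, Real.coe_toNNReal _ (sq_nonneg σ), mul_comm (2 * Real.pi),
    Real.sqrt_mul (sq_nonneg σ), Real.sqrt_sq hσ.le]
  congr 2
  field_simp

theorem two_le_sqrt_two_mul_pi : 2 ≤ √(2 * Real.pi) := by
  refine Real.le_sqrt_of_sq_le ?_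
  linarith [Real.pi_gt_three]

theorem gaussianPDFReal_le {σ : ℝ} (hσ : 0 < σ) (μ a : ℝ) :
    gaussianPDFReal μ (σ ^ 2).toNNReal a ≤ 1 / (2 * σ) := by
  rw [gaussianPDFReal_eq_exp hσ]
  have h1 : Real.exp (-(((a - μ) / σ) ^ 2 / 2)) ≤ 1 := Real.exp_le_one_iff.2 (by
    linarith [sq_nonneg ((a - μ) / σ)])
  calc _ ≤ (σ * √(2 * Real.pi))⁻¹ * 1 := by gcongr
    _ ≤ (σ * 2)⁻¹ * 1 := by
      gcongr
      exact two_le_sqrt_two_mul_pi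
    _ = _ := by
      field_simp

/-- With `a = μ + σ z` this reduces to `|z| exp (-z² / 2) ≤ 1` and `√(2π) ≥ 2`. Weighting the
density by `|a|` is what makes the ratio estimate uniform in the location of the singularity. -/
theorem abs_mul_gaussianPDFReal_le {σ : ℝ} (hσ : 0 < σ) {μ : ℝ} (hμ : |μ| ≤ 1) (a : ℝ) :
    |a| * gaussianPDFReal μ (σ ^ 2).toNNReal a ≤ (1 + σ) / σ / 2 := by
  rw [gaussianPDFReal_eq_exp hσ]
  set z := (a - μ) / σ with hz
  have ha : |a| ≤ 1 + σ * |z| := by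
    have : a = μ + σ * z := by
      rw [hz]
      field_simp
      ring
    calc |a| = |μ + σ * z| := by rw [← this]
      _ ≤ |μ| + |σ * z| := abs_add_le _ _
      _ ≤ _ := by
        rw [abs_mul, abs_of_pos hσ]
        linarith
  have hE : 0 < Real.exp (-(z ^ 2 / 2)) := Real.exp_pos _
  have h1 : Real.exp (-(z ^ 2 / 2)) ≤ 1 := Real.exp_le_one_iff.2 (by linarith [sq_nonneg z])
  have h2 : |z| * Real.exp (-(z ^ 2 / 2)) ≤ 1 := by
    have h3 := Real.add_one_le_exp (z ^ 2 / 2)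
    have h4 : |z| ≤ Real.exp (z ^ 2 / 2) := by
      nlinarith [sq_abs z, sq_nonneg (|z| - 1)]
    calc |z| * Real.exp (-(z ^ 2 / 2)) ≤ Real.exp (z ^ 2 / 2) * Real.exp (-(z ^ 2 / 2)) := by gcongr
      _ = 1 := by rw [← Real.exp_add]; simp
  have h5 : |a| * Real.exp (-(z ^ 2 / 2)) ≤ 1 + σ := by
    calc |a| * Real.exp (-(z ^ 2 / 2)) ≤ (1 + σ * |z|) * Real.exp (-(z ^ 2 / 2)) := by gcongr
      _ = Real.exp (-(z ^ 2 / 2)) + σ * (|z| * Real.exp (-(z ^ 2 / 2))) := by ring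
      _ ≤ 1 + σ * 1 := by gcongr
      _ = _ := by ring
  calc |a| * ((σ * √(2 * Real.pi))⁻¹ * Real.exp (-(z ^ 2 / 2)))
      = (σ * √(2 * Real.pi))⁻¹ * (|a| * Real.exp (-(z ^ 2 / 2))) := by ring
    _ ≤ (σ * 2)⁻¹ * (1 + σ) := by
      gcongr
      exact two_le_sqrt_two_mul_pi
    _ = _ := by
      field_simp

/-- Away from the singularity the integrand is at most `1`; within distance `1` the density is at
most `1 / (2σ)` and the integral of `|x|^(-1/2)` over `[-1, 1]` is `4`. -/
theorem lintegral_sqrt_inv_abs_add_le {σ : ℝ} (hσ : 0 < σ) (μ c : ℝ) :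
    ∫⁻ a, ENNReal.ofReal √(|a + c|⁻¹) ∂gaussianReal μ (σ ^ 2).toNNReal ≤
      ENNReal.ofReal (1 + 2 / σ) := by
  have hv := toNNReal_sq_ne_zero hσ
  rw [lintegral_gaussianReal hv (by fun_prop)]
  have hpt : ∀ a, gaussianPDF μ (σ ^ 2).toNNReal a * ENNReal.ofReal √(|a + c|⁻¹) ≤
      gaussianPDF μ (σ ^ 2).toNNReal a + ENNReal.ofReal (1 / (2 * σ)) *
        {x : ℝ | |x + c| ≤ 1}.indicator (fun x => ENNReal.ofReal (|x + c| ^ (-(1 / 2 : ℝ)))) a := by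
    intro a
    by_cases h : |a + c| ≤ 1
    · refine le_trans ?_ le_add_self
      rw [Set.indicator_of_mem (by exact h)]
      refine mul_le_mul' (ENNReal.ofReal_le_ofReal (gaussianPDFReal_le hσ μ a)) ?_
      rw [Real.sqrt_inv, Real.rpow_neg (abs_nonneg _), ← Real.sqrt_eq_rpow]
    · refine le_trans ?_ le_self_add
      have h1 : √(|a + c|⁻¹) ≤ 1 := by
        rw [Real.sqrt_le_one]
        exact inv_le_one_of_one_le₀ (not_le.1 h).le
      calc _ ≤ gaussianPDF μ (σ ^ 2).toNNReal a * ENNReal.ofReal 1 := by gcongr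
        _ = _ := by simp
  calc _ ≤ ∫⁻ a, _ := lintegral_mono hpt
    _ = 1 + ENNReal.ofReal (1 / (2 * σ)) * ∫⁻ a, {x : ℝ | |x + c| ≤ 1}.indicator
        (fun x => ENNReal.ofReal (|x + c| ^ (-(1 / 2 : ℝ)))) a := by
      rw [lintegral_add_left (measurable_gaussianPDF _ _), lintegral_gaussianPDF_eq_one μ hv,
        lintegral_const_mul' _ _ ENNReal.ofReal_ne_top]
    _ ≤ 1 + ENNReal.ofReal (1 / (2 * σ)) *
        ENNReal.ofReal (2 * (1 ^ (1 - 1 / 2 : ℝ) / (1 - 1 / 2))) := by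
      gcongr
      exact lintegral_indicator_rpow_neg_le (by norm_num) zero_le_one c
    _ = _ := by
      rw [← ENNReal.ofReal_mul (by positivity), ← ENNReal.ofReal_one,
        ← ENNReal.ofReal_add zero_le_one (by norm_num; positivity), Real.one_rpow]
      congr 1
      field_simp
      norm_num

theorem lintegral_sqrt_abs_le {μ : ℝ} (hμ : |μ| ≤ 1) (v : ℝ≥0) :
    ∫⁻ a, ENNReal.ofReal √|a| ∂gaussianReal μ v ≤ ENNReal.ofReal (2 + v) := by
  have hm : MemLp (fun x : ℝ => x) 2 (gaussianReal μ v) := memLp_id_gaussianReal 2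
  have hvar := variance_eq_sub hm
  rw [variance_fun_id_gaussianReal, integral_id_gaussianReal] at hvar
  have hint : Integrable (fun x : ℝ => x ^ 2) (gaussianReal μ v) := hm.integrable_sq
  have hval : ∫ x, (1 + x ^ 2) ∂gaussianReal μ v = 1 + (v + μ ^ 2) := by
    rw [integral_add (integrable_const _) hint]
    simp only [integral_const, probReal_univ, smul_eq_mul, mul_one]
    have : ∫ x, x ^ 2 ∂gaussianReal μ v = v + μ ^ 2 := by
      have h2 : ((fun x : ℝ => x) ^ 2) = fun x : ℝ => x ^ 2 := rfl
      rw [h2] at hvar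
      linarith
    rw [this]
  calc _ ≤ ∫⁻ a, ENNReal.ofReal (1 + a ^ 2) ∂gaussianReal μ v := by
        refine lintegral_mono fun a => ENNReal.ofReal_le_ofReal ?_
        refine (Real.sqrt_le_left (by positivity)).2 ?_
        nlinarith [sq_abs a, sq_nonneg (|a| - 1), abs_nonneg a, sq_nonneg (a ^ 2)]
    _ = ENNReal.ofReal (1 + (v + μ ^ 2)) := by
      rw [← ofReal_integral_eq_lintegral_ofReal (f := fun a => 1 + a ^ 2)
        ((integrable_const _).add hint)
        (ae_of_all _ fun a => by positivity)]
      exact congrArg _ hval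
    _ ≤ _ := by
      refine ENNReal.ofReal_le_ofReal ?_
      have := sq_abs μ
      nlinarith [abs_nonneg μ]

/-- Near the singularity `a = -c` the sizes of `a` and `c` are comparable, `2|c|/3 ≤ |a| ≤ 2|c|`.
Writing `|a|^(3/4) = |a| * |a|^(-1/4)` uses up the bound `hd` for the weighted density and leaves an
integrable power of `|a + c|`. -/
theorem rpow_ratio_mul_pdf_le {κ d : ℝ} (hκ : 1 ≤ κ) {a c : ℝ} (hc : c ≠ 0)
    (hd : |a| * d ≤ κ / 2) (h : |a + c| < 1 / (2 * κ) * |a|) :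
    |a + c| ≤ |c| / κ ∧ (|a| / |a + c|) ^ (3 / 4 : ℝ) * d ≤
      (κ / 2 * (2 * |c| / 3) ^ (-(1 / 4) : ℝ)) * |a + c| ^ (-(3 / 4) : ℝ) := by
  have hκ0 : 0 < κ := by linarith
  have ha : 0 < |a| := by
    by_contra hh
    have : |a| = 0 := le_antisymm (not_lt.1 hh) (abs_nonneg _)
    rw [this, mul_zero] at h
    exact absurd h (not_lt.2 (abs_nonneg _))
  have hlam : 1 / (2 * κ) ≤ 1 / 2 := by
    apply one_div_le_one_div_of_le <;> linarith
  have h1 : |a + c| ≤ 1 / 2 * |a| := h.le.trans (mul_le_mul_of_nonneg_right hlam ha.le)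
  have h2 : |a| ≤ |a + c| + |c| := by
    calc |a| = |(a + c) - c| := by ring_nf
      _ ≤ _ := abs_sub _ _
  have h3 : |c| ≤ |a + c| + |a| := by
    calc |c| = |(a + c) - a| := by ring_nf
      _ ≤ _ := abs_sub _ _
  refine ⟨?_, ?_⟩
  · calc |a + c| ≤ 1 / (2 * κ) * |a| := h.le
      _ ≤ 1 / (2 * κ) * (2 * |c|) := by
        gcongr
        linarith
      _ = _ := by field_simp
  · have h4 : 2 * |c| / 3 ≤ |a| := by linarith
    have hc0 : 0 < 2 * |c| / 3 := by
      have := abs_pos.2 hc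
      positivity
    have h5 : |a| ^ (3 / 4 : ℝ) = |a| ^ (-(1 / 4) : ℝ) * |a| := by
      rw [← Real.rpow_add_one ha.ne']
      norm_num
    rw [Real.div_rpow ha.le (abs_nonneg _), h5, div_eq_mul_inv, ← Real.rpow_neg (abs_nonneg _)]
    calc |a| ^ (-(1 / 4) : ℝ) * |a| * |a + c| ^ (-(3 / 4) : ℝ) * d
        = ((|a| * d) * |a| ^ (-(1 / 4) : ℝ)) * |a + c| ^ (-(3 / 4) : ℝ) := by ring
      _ ≤ _ := by
        gcongr ?_ * ?_ * _
        exact Real.rpow_le_rpow_of_nonpos hc0 h4 (by norm_num)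

/-- The ratio of a Gaussian variable to an affine function of it has a moment of order `3 / 4`
bounded independently of the coefficients. -/
theorem lintegral_ratio_le {σ : ℝ} (hσ : 0 < σ) {μ : ℝ} (hμ : |μ| ≤ 1) (p q : ℝ) :
    ∫⁻ a, ENNReal.ofReal ((|a * p| / |q + a * p|) ^ (3 / 4 : ℝ)) ∂gaussianReal μ (σ ^ 2).toNNReal ≤
      ENNReal.ofReal (6.12 * ((1 + σ) / σ) ^ (3 / 4 : ℝ)) := by
  have hv := toNNReal_sq_ne_zero hσ
  set κ := (1 + σ) / σ with hκdef
  have hκ : 1 ≤ κ := by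
    rw [hκdef, one_le_div hσ]
    linarith
  have hκ0 : 0 < κ := by linarith
  have hκ34 : 1 ≤ κ ^ (3 / 4 : ℝ) := Real.one_le_rpow hκ (by norm_num)
  have hsmall : ∀ f : ℝ → ℝ, (∀ a, f a ≤ 1) →
      ∫⁻ a, ENNReal.ofReal (f a) ∂gaussianReal μ (σ ^ 2).toNNReal ≤
        ENNReal.ofReal (6.12 * κ ^ (3 / 4 : ℝ)) := by
    intro f hf
    calc _ ≤ ∫⁻ _, ENNReal.ofReal 1 ∂gaussianReal μ (σ ^ 2).toNNReal :=
          lintegral_mono fun a => ENNReal.ofReal_le_ofReal (hf a)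
      _ = ENNReal.ofReal 1 := by simp
      _ ≤ _ := ENNReal.ofReal_le_ofReal (by linarith)
  by_cases hp : p = 0
  · refine hsmall _ fun a => ?_
    rw [hp, mul_zero, abs_zero, zero_div, Real.zero_rpow (by norm_num)]
    exact zero_le_one
  -- After division by `p` only the position `-c` of the singularity is left.
  obtain ⟨c, rfl⟩ : ∃ c, q = c * p := ⟨q / p, by field_simp⟩
  have hrat : ∀ a, |a * p| / |c * p + a * p| = |a| / |a + c| := fun a => by
    rw [← add_mul, abs_mul, abs_mul, mul_div_mul_right _ _ (abs_ne_zero.2 hp), add_comm]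
  simp only [hrat]
  by_cases hc : c = 0
  · refine hsmall _ fun a => ?_
    rw [hc, add_zero]
    exact Real.rpow_le_one (by positivity) (div_self_le_one _) (by norm_num)
  rw [lintegral_gaussianReal hv (by fun_prop)]
  set C := κ / 2 * (2 * |c| / 3) ^ (-(1 / 4) : ℝ)
  have hcpos := abs_pos.2 hc
  -- Either the ratio is at most `2κ`, or `a` lies in the window around `-c` where
  -- `rpow_ratio_mul_pdf_le` applies.
  have hpt : ∀ a, gaussianPDF μ (σ ^ 2).toNNReal a *
        ENNReal.ofReal ((|a| / |a + c|) ^ (3 / 4 : ℝ)) ≤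
      gaussianPDF μ (σ ^ 2).toNNReal a * ENNReal.ofReal ((2 * κ) ^ (3 / 4 : ℝ)) +
        ENNReal.ofReal C * {x : ℝ | |x + c| ≤ |c| / κ}.indicator
          (fun x => ENNReal.ofReal (|x + c| ^ (-(3 / 4) : ℝ))) a := by
    intro a
    by_cases h : |a + c| < 1 / (2 * κ) * |a|
    · refine le_trans ?_ le_add_self
      obtain ⟨h1, h2⟩ := rpow_ratio_mul_pdf_le hκ hc
        (abs_mul_gaussianPDFReal_le hσ hμ a) h
      rw [Set.indicator_of_mem (by exact h1), gaussianPDF,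
        ← ENNReal.ofReal_mul (gaussianPDFReal_nonneg _ _ _), ← ENNReal.ofReal_mul (by positivity),
        mul_comm]
      exact ENNReal.ofReal_le_ofReal h2
    · refine le_trans ?_ le_self_add
      gcongr
      refine div_le_of_le_mul₀ (abs_nonneg _) (by positivity) ?_
      have := not_lt.1 h
      rw [div_mul_eq_mul_div, one_mul, div_le_iff₀ (by positivity)] at this
      linarith
  calc _ ≤ ∫⁻ a, _ := lintegral_mono hpt
    _ = ENNReal.ofReal ((2 * κ) ^ (3 / 4 : ℝ)) + ENNReal.ofReal C *
        ∫⁻ a, {x : ℝ | |x + c| ≤ |c| / κ}.indicator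
          (fun x => ENNReal.ofReal (|x + c| ^ (-(3 / 4) : ℝ))) a := by
      rw [lintegral_add_left ((measurable_gaussianPDF _ _).mul_const _),
        lintegral_mul_const _ (measurable_gaussianPDF _ _), lintegral_gaussianPDF_eq_one μ hv,
        one_mul, lintegral_const_mul' _ _ ENNReal.ofReal_ne_top]
    _ ≤ ENNReal.ofReal ((2 * κ) ^ (3 / 4 : ℝ)) + ENNReal.ofReal C *
        ENNReal.ofReal (2 * ((|c| / κ) ^ (1 - 3 / 4 : ℝ) / (1 - 3 / 4))) := by
      gcongr
      exact lintegral_indicator_rpow_neg_le (by norm_num) (by positivity) c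
    _ = ENNReal.ofReal ((2 * κ) ^ (3 / 4 : ℝ) +
        C * (2 * ((|c| / κ) ^ (1 - 3 / 4 : ℝ) / (1 - 3 / 4)))) := by
      rw [← ENNReal.ofReal_mul (by positivity), ← ENNReal.ofReal_add (by positivity)]
      have : (0 : ℝ) < 1 - 3 / 4 := by norm_num
      positivity
    _ ≤ _ := by
      refine ENNReal.ofReal_le_ofReal ?_
      have e1 : (2 : ℝ) ^ (3 / 4 : ℝ) ≤ 1.683 := by
        rw [← Real.rpow_le_rpow_iff (z := 4) (by positivity) (by norm_num) (by norm_num),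
          ← Real.rpow_mul (by norm_num)]
        norm_num
      have e2 : (3 / 2 : ℝ) ^ (1 / 4 : ℝ) ≤ 1.107 := by
        rw [← Real.rpow_le_rpow_iff (z := 4) (by positivity) (by norm_num) (by norm_num),
          ← Real.rpow_mul (by norm_num)]
        norm_num
      -- The power `|c|^(1/4)` from the length of the window cancels `|c|^(-1/4)` in `C`, and `κ *
      -- κ^(-1/4)` leaves `κ^(3/4)`. The constants add up to at most `1.683 + 4 * 1.107 < 6.12`.
      have e3 : C * (2 * ((|c| / κ) ^ (1 - 3 / 4 : ℝ) / (1 - 3 / 4))) =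
          4 * (3 / 2 : ℝ) ^ (1 / 4 : ℝ) * κ ^ (3 / 4 : ℝ) := by
        have f1 : (|c| / κ) ^ (1 - 3 / 4 : ℝ) =
            (2 * |c| / 3) ^ (1 / 4 : ℝ) * ((3 / 2 : ℝ) ^ (1 / 4 : ℝ) * (κ ^ (1 / 4 : ℝ))⁻¹) := by
          rw [← Real.inv_rpow hκ0.le, ← Real.mul_rpow (by norm_num) (by positivity),
            ← Real.mul_rpow (by positivity) (by positivity)]
          norm_num
          congr 1
          field_simp
        have f2 : κ = κ ^ (3 / 4 : ℝ) * κ ^ (1 / 4 : ℝ) := by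
          rw [← Real.rpow_add hκ0]
          norm_num
        have f3 : 0 < κ ^ (1 / 4 : ℝ) := by positivity
        have f4 : 0 < (2 * |c| / 3) ^ (1 / 4 : ℝ) := by positivity
        simp only [C]
        rw [f1, Real.rpow_neg (by positivity)]
        nth_rewrite 1 [f2]
        field_simp
        norm_num
      rw [e3, Real.mul_rpow (by norm_num) hκ0.le]
      nlinarith

/-! ### The random triangular system -/

instance isProbabilityMeasure_pi_pi_gaussianReal {n : ℕ} (a : Fin n → Fin n → ℝ)
    (v : Fin n → Fin n → ℝ≥0) :
    IsProbabilityMeasure (Measure.pi fun i => Measure.pi fun j => gaussianReal (a i j) (v i j)) :=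
  inferInstance

/-- The variances of the entries of the random triangular matrix. -/
noncomputable def triangularVariance (n : ℕ) (σ : ℝ) (i j : Fin n) : ℝ≥0 :=
  if j ≤ i then (σ ^ 2).toNNReal else 0

theorem smoothedTriangular_eq {n : ℕ} (Lbar : Matrix (Fin n) (Fin n) ℝ) (bbar : Fin n → ℝ)
    (σ : ℝ) : smoothedTriangular Lbar bbar σ =
      (Measure.pi fun i => Measure.pi fun j =>
        gaussianReal (Lbar i j) (triangularVariance n σ i j)).prod
      (Measure.pi fun i => gaussianReal (bbar i) (σ ^ 2).toNNReal) :=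
  rfl

instance isProbabilityMeasure_smoothedTriangular {n : ℕ} (Lbar : Matrix (Fin n) (Fin n) ℝ)
    (bbar : Fin n → ℝ) (σ : ℝ) : IsProbabilityMeasure (smoothedTriangular Lbar bbar σ) := by
  rw [smoothedTriangular_eq]
  have := isProbabilityMeasure_pi_pi_gaussianReal Lbar (triangularVariance n σ)
  infer_instance

section Coordinates

variable {n : ℕ} {Lbar : Matrix (Fin n) (Fin n) ℝ} {bbar : Fin n → ℝ} {σ : ℝ}

theorem lintegral_smoothed_le_of_rhs {f : (Fin n → Fin n → ℝ) × (Fin n → ℝ) → ℝ≥0∞}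
    (hf : Measurable f) (j : Fin n) {B : ℝ≥0∞}
    (h : ∀ L b, ∫⁻ a, f (L, Function.update b j a) ∂gaussianReal (bbar j) (σ ^ 2).toNNReal ≤ B) :
    ∫⁻ p, f p ∂smoothedTriangular Lbar bbar σ ≤ B := by
  have := isProbabilityMeasure_pi_pi_gaussianReal Lbar (triangularVariance n σ)
  rw [smoothedTriangular_eq, lintegral_prod _ hf.aemeasurable]
  refine (lintegral_mono (g := fun _ => B) fun L => ?_).trans (by simp)
  exact lintegral_pi_le_of_forall_update _ (hf.comp measurable_prodMk_left) j fun b => h L b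

theorem lintegral_smoothed_le_of_entry {f : (Fin n → Fin n → ℝ) × (Fin n → ℝ) → ℝ≥0∞}
    (hf : Measurable f) (j k : Fin n) {B : ℝ≥0∞}
    (h : ∀ L b, ∫⁻ a, f (Function.update L j (Function.update (L j) k a), b)
      ∂gaussianReal (Lbar j k) (triangularVariance n σ j k) ≤ B) :
    ∫⁻ p, f p ∂smoothedTriangular Lbar bbar σ ≤ B := by
  have := isProbabilityMeasure_pi_pi_gaussianReal Lbar (triangularVariance n σ)
  rw [smoothedTriangular_eq, lintegral_prod_symm _ hf.aemeasurable]
  refine (lintegral_mono (g := fun _ => B) fun b => ?_).trans (by simp)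
  have hrow : ∀ i, IsProbabilityMeasure
      (Measure.pi fun k => gaussianReal (Lbar i k) (triangularVariance n σ i k)) :=
    fun i => inferInstance
  refine lintegral_pi_le_of_forall_update _ (hf.comp measurable_prodMk_right) j fun L => ?_
  refine lintegral_pi_le_of_forall_update
    (fun k => gaussianReal (Lbar j k) (triangularVariance n σ j k))
    (f := fun r => f (Function.update L j r, b))
    (hf.comp ((measurable_update L).prodMk measurable_const)) k fun r => ?_
  have := h (Function.update L j r) b
  simpa using this

theorem ae_smoothed_of_rhs {P : (Fin n → Fin n → ℝ) × (Fin n → ℝ) → Prop}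
    (hP : MeasurableSet {p | P p}) (j : Fin n)
    (h : ∀ L b, ∀ᵐ a ∂gaussianReal (bbar j) (σ ^ 2).toNNReal, P (L, Function.update b j a)) :
    ∀ᵐ p ∂smoothedTriangular Lbar bbar σ, P p := by
  rw [ae_iff, ← nonpos_iff_eq_zero, ← Set.compl_ofPred, ← lintegral_indicator_one hP.compl]
  refine lintegral_smoothed_le_of_rhs (measurable_one.indicator hP.compl) j fun L b => ?_
  refine (lintegral_eq_zero_of_ae_eq_zero ?_).le
  filter_upwards [h L b] with a ha
  exact Set.indicator_of_notMem (Set.notMem_compl_iff.2 ha) _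

theorem ae_smoothed_of_entry {P : (Fin n → Fin n → ℝ) × (Fin n → ℝ) → Prop}
    (hP : MeasurableSet {p | P p}) (j k : Fin n)
    (h : ∀ L b, ∀ᵐ a ∂gaussianReal (Lbar j k) (triangularVariance n σ j k),
      P (Function.update L j (Function.update (L j) k a), b)) :
    ∀ᵐ p ∂smoothedTriangular Lbar bbar σ, P p := by
  rw [ae_iff, ← nonpos_iff_eq_zero, ← Set.compl_ofPred, ← lintegral_indicator_one hP.compl]
  refine lintegral_smoothed_le_of_entry (measurable_one.indicator hP.compl) j k fun L b => ?_
  refine (lintegral_eq_zero_of_ae_eq_zero ?_).le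
  filter_upwards [h L b] with a ha
  exact Set.indicator_of_notMem (Set.notMem_compl_iff.2 ha) _

end Coordinates

theorem ae_gaussianReal_ne {σ : ℝ} (hσ : 0 < σ) (μ c : ℝ) :
    ∀ᵐ a ∂gaussianReal μ (σ ^ 2).toNNReal, a ≠ c := by
  have := nullSingletonClass_gaussianReal (μ := μ) (toNNReal_sq_ne_zero hσ)
  rw [ae_iff]
  simp

/-- The numerator of the quotient defining the entry `i` of the solution. -/
noncomputable def fsolveNum {n : ℕ} (L : Fin n → Fin n → ℝ) (b : Fin n → ℝ) (i : Fin n) : ℝ :=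
  b i - ∑ k ∈ Finset.Iio i, L i k * fsolve L b k

/-- Components before `i` do not see `b i`, so the numerator is a shifted Gaussian when the other
data are frozen. This holds without any condition on `L i i`, unlike an inverse moment of `x_i`
itself. -/
theorem fsolveNum_update {n : ℕ} (L : Fin n → Fin n → ℝ) (b : Fin n → ℝ) (i : Fin n) (a : ℝ) :
    fsolveNum L (Function.update b i a) i = a + -∑ k ∈ Finset.Iio i, L i k * fsolve L b k := by
  rw [fsolveNum, Function.update_self, sub_eq_add_neg]
  congr 2
  refine Finset.sum_congr rfl fun k hk => ?_
  rw [fsolve_of_rhs_eq_off L (b := b) (j := i) (fun k hk => Function.update_of_ne hk _ _),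
    fsolve_single_of_lt L (Finset.mem_Iio.1 hk), mul_zero, add_zero]

section Measurability

variable {n : ℕ}

theorem measurable_entry (i j : Fin n) :
    Measurable fun p : (Fin n → Fin n → ℝ) × (Fin n → ℝ) => p.1 i j :=
  (measurable_pi_apply j).comp ((measurable_pi_apply i).comp measurable_fst)

theorem measurable_rhs (i : Fin n) :
    Measurable fun p : (Fin n → Fin n → ℝ) × (Fin n → ℝ) => p.2 i :=
  (measurable_pi_apply i).comp measurable_snd

theorem measurable_sol (i : Fin n) :
    Measurable fun p : (Fin n → Fin n → ℝ) × (Fin n → ℝ) => fsolve p.1 p.2 i :=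
  measurable_fsolve measurable_entry measurable_rhs i

theorem measurable_sol_single (i j : Fin n) :
    Measurable fun p : (Fin n → Fin n → ℝ) × (Fin n → ℝ) => fsolve p.1 (Pi.single j 1) i :=
  measurable_fsolve (b := fun _ => Pi.single j 1) measurable_entry (fun _ => measurable_const) i

theorem measurable_fsolveNum (i : Fin n) :
    Measurable fun p : (Fin n → Fin n → ℝ) × (Fin n → ℝ) => fsolveNum p.1 p.2 i :=
  (measurable_rhs i).sub (Finset.measurable_sum _ fun k _ =>
    (measurable_entry i k).mul (measurable_sol k))

theorem measurable_sumTree_eval {ε : ℝ} (M : FinitePrecision ε) {Ω : Type*} [MeasurableSpace Ω]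
    {α : Type} {f : Ω → α → ℝ} (hf : ∀ a, Measurable fun ω => f ω a) (t : SumTree α) :
    Measurable fun ω => t.eval M.add (f ω) := by
  induction t with
  | leaf a => exact hf a
  | node s t hs ht => exact M.measurable_add.comp (hs.prodMk ht)

theorem measurable_forwardSubst {ε : ℝ} (M : FinitePrecision ε) (T : SummationScheme n)
    (i : Fin n) :
    Measurable fun p : (Fin n → Fin n → ℝ) × (Fin n → ℝ) =>
      forwardSubst M T (Matrix.of p.1) p.2 i := by
  have hr : ∀ i j, Measurable fun p : (Fin n → Fin n → ℝ) × (Fin n → ℝ) => M.read (p.1 i j) :=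
    fun i j => M.measurable_read.comp (measurable_entry i j)
  have hrb : ∀ i, Measurable fun p : (Fin n → Fin n → ℝ) × (Fin n → ℝ) => M.read (p.2 i) :=
    fun i => M.measurable_read.comp (measurable_rhs i)
  induction i using fin_strong_induction with
  | h i ih =>
    by_cases h : 0 < i.val
    · have hx : (fun p : (Fin n → Fin n → ℝ) × (Fin n → ℝ) =>
          forwardSubst M T (Matrix.of p.1) p.2 i) = fun p =>
            M.div (M.sub (M.read (p.2 i))
              ((T.tree i h).eval M.add fun j : Fin i.val =>
                M.mul (M.read (p.1 i ⟨j.val, j.isLt.trans i.isLt⟩))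
                  (forwardSubst M T (Matrix.of p.1) p.2 ⟨j.val, j.isLt.trans i.isLt⟩)))
              (M.read (p.1 i i)) := by
        funext p
        rw [forwardSubst, dif_pos h]
        rfl
      rw [hx]
      refine M.measurable_div.comp ((M.measurable_sub.comp ((hrb i).prodMk
        (measurable_sumTree_eval M (fun j => ?_) _))).prodMk (hr i i))
      exact M.measurable_mul.comp ((hr i _).prodMk (ih _ j.isLt))
    · have hx : (fun p : (Fin n → Fin n → ℝ) × (Fin n → ℝ) =>
          forwardSubst M T (Matrix.of p.1) p.2 i) = fun p =>
            M.div (M.read (p.2 i)) (M.read (p.1 i i)) := by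
        funext p
        rw [forwardSubst, dif_neg h]
        rfl
      rw [hx]
      exact M.measurable_div.comp ((hrb i).prodMk (hr i i))

theorem measurable_inv_mulVec (i : Fin n) :
    Measurable fun p : (Fin n → Fin n → ℝ) × (Fin n → ℝ) => ((Matrix.of p.1)⁻¹ *ᵥ p.2) i := by
  have hdet : Measurable fun p : (Fin n → Fin n → ℝ) × (Fin n → ℝ) => (Matrix.of p.1).det :=
    (continuous_matrixOf.2 continuous_id).matrix_det.measurable.comp measurable_fst
  have hadj : ∀ j, Measurable fun p : (Fin n → Fin n → ℝ) × (Fin n → ℝ) =>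
      (Matrix.of p.1).adjugate i j := fun j =>
    ((continuous_matrixOf.2 continuous_id).matrix_adjugate.matrix_elem i j).measurable.comp
      measurable_fst
  simp only [Matrix.mulVec, dotProduct, Matrix.inv_def, Ring.inverse_eq_inv', Matrix.smul_apply,
    smul_eq_mul]
  exact Finset.measurable_sum _ fun j _ => (hdet.inv.mul (hadj j)).mul (measurable_rhs j)

theorem log10_monotone : Monotone log10 := fun _ _ hst =>
  EReal.monotone_div_right_of_nonneg
    (EReal.coe_nonneg.2 (Real.log_nonneg (by norm_num))) (ENNReal.log_monotone hst)

theorem measurable_lossOfPrecision {ε : ℝ} (M : FinitePrecision ε) (T : SummationScheme n) :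
    Measurable fun p : (Fin n → Fin n → ℝ) × (Fin n → ℝ) =>
      lossOfPrecision M T (Matrix.of p.1) p.2 := by
  have hdet : Measurable fun p : (Fin n → Fin n → ℝ) × (Fin n → ℝ) => (Matrix.of p.1).det :=
    (continuous_matrixOf.2 continuous_id).matrix_det.measurable.comp measurable_fst
  unfold lossOfPrecision
  refine Measurable.ite (hdet (measurableSet_singleton 0)) measurable_const ?_
  -- Monotonicity gives measurability of the subtraction including infinite values.
  have hanti : Antitone fun t : EReal => log10 (ENNReal.ofReal ε)⁻¹ - t :=
    fun s t hst => EReal.sub_le_sub le_rfl hst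
  refine hanti.measurable.comp (log10_monotone.measurable.comp (Measurable.inv ?_))
  unfold vecRelError relError
  refine Measurable.iSup fun i => ?_
  exact (((measurable_forwardSubst M T i).sub (measurable_inv_mulVec i)).abs.ennreal_ofReal).div
    (measurable_inv_mulVec i).abs.ennreal_ofReal

end Measurability

/-! ### Bounds for means -/

/-- The function `f` is integrable and its mean is at most `B`. -/
def MeanLE {Ω : Type*} [MeasurableSpace Ω] (μ : Measure Ω) (f : Ω → ℝ) (B : ℝ) : Prop :=
  Integrable f μ ∧ ∫ ω, f ω ∂μ ≤ B

namespace MeanLE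

variable {Ω : Type*} [MeasurableSpace Ω] {μ : Measure Ω} {f g : Ω → ℝ} {B C : ℝ}

theorem of_lintegral (hf : Measurable f) (h0 : ∀ ω, 0 ≤ f ω) (hB : 0 ≤ B)
    (h : ∫⁻ ω, ENNReal.ofReal (f ω) ∂μ ≤ ENNReal.ofReal B) : MeanLE μ f B := by
  refine ⟨⟨hf.aestronglyMeasurable, ?_⟩, ?_⟩
  · rw [hasFiniteIntegral_iff_ofReal (ae_of_all _ h0)]
    exact h.trans_lt ENNReal.ofReal_lt_top
  · rw [integral_eq_lintegral_of_nonneg_ae (ae_of_all _ h0) hf.aestronglyMeasurable]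
    exact ENNReal.toReal_le_of_le_ofReal hB h

theorem add (hf : MeanLE μ f B) (hg : MeanLE μ g C) : MeanLE μ (fun ω => f ω + g ω) (B + C) :=
  ⟨hf.1.add hg.1, (integral_add hf.1 hg.1).trans_le (add_le_add hf.2 hg.2)⟩

theorem const_mul (hf : MeanLE μ f B) {c : ℝ} (hc : 0 ≤ c) :
    MeanLE μ (fun ω => c * f ω) (c * B) :=
  ⟨hf.1.const_mul c, (integral_const_mul c f).trans_le (mul_le_mul_of_nonneg_left hf.2 hc)⟩

theorem const [IsProbabilityMeasure μ] (c : ℝ) : MeanLE μ (fun _ => c) c :=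
  ⟨integrable_const c, by simp⟩

theorem sum {ι : Type*} (s : Finset ι) {f : ι → Ω → ℝ} {B : ι → ℝ}
    (h : ∀ i ∈ s, MeanLE μ (f i) (B i)) : MeanLE μ (fun ω => ∑ i ∈ s, f i ω) (∑ i ∈ s, B i) :=
  ⟨integrable_finsetSum s fun i hi => (h i hi).1,
    (integral_finsetSum s fun i hi => (h i hi).1).trans_le
      (Finset.sum_le_sum fun i hi => (h i hi).2)⟩

theorem lintegral_le (hf : MeanLE μ f B) (h0 : ∀ ω, 0 ≤ f ω) :
    ∫⁻ ω, ENNReal.ofReal (f ω) ∂μ ≤ ENNReal.ofReal B := by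
  rw [← ofReal_integral_eq_lintegral_ofReal hf.1 (ae_of_all _ h0)]
  exact ENNReal.ofReal_le_ofReal hf.2

end MeanLE

section Smoothed

variable {n : ℕ} {Lbar : Matrix (Fin n) (Fin n) ℝ} {bbar : Fin n → ℝ} {σ : ℝ}

theorem ae_lower (h0 : ∀ i j, i < j → Lbar i j = 0) :
    ∀ᵐ p ∂smoothedTriangular Lbar bbar σ, ∀ i j, i < j → p.1 i j = 0 := by
  rw [ae_all_iff]
  intro i
  rw [ae_all_iff]
  intro j
  by_cases hij : i < j
  · have : ∀ᵐ p ∂smoothedTriangular Lbar bbar σ, p.1 i j = 0 := by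
      refine ae_smoothed_of_entry (measurable_entry i j (measurableSet_singleton 0)) i j
        fun L b => ?_
      rw [triangularVariance, if_neg (not_le.2 hij), h0 i j hij, gaussianReal_zero_var]
      simp only [Function.update_self]
      exact (ae_dirac_iff (p := fun a : ℝ => a = 0) (measurableSet_singleton 0)).2 rfl
    filter_upwards [this] with p hp _ using hp
  · exact ae_of_all _ fun p h => absurd h hij

theorem ae_diag_ne_zero (hσ : 0 < σ) :
    ∀ᵐ p ∂smoothedTriangular Lbar bbar σ, ∀ i, p.1 i i ≠ 0 := by
  rw [ae_all_iff]
  intro i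
  refine ae_smoothed_of_entry (measurable_entry i i (measurableSet_singleton 0)).compl i i
    fun L b => ?_
  rw [triangularVariance, if_pos le_rfl]
  simp only [Function.update_self]
  exact ae_gaussianReal_ne hσ _ 0

theorem ae_fsolveNum_ne_zero (hσ : 0 < σ) :
    ∀ᵐ p ∂smoothedTriangular Lbar bbar σ, ∀ i, fsolveNum p.1 p.2 i ≠ 0 := by
  rw [ae_all_iff]
  intro i
  refine ae_smoothed_of_rhs (measurable_fsolveNum i (measurableSet_singleton 0)).compl i
    fun L b => ?_
  simp only [fsolveNum_update]
  filter_upwards [ae_gaussianReal_ne hσ (bbar i) (∑ k ∈ Finset.Iio i, L i k * fsolve L b k)]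
    with a ha h
  exact ha (by linarith)

theorem meanLE_rhs_ratio (hσ : 0 < σ) (hb : ∀ i, |bbar i| ≤ 1) (i j : Fin n) :
    MeanLE (smoothedTriangular Lbar bbar σ)
      (fun p => (|p.2 j * fsolve p.1 (Pi.single j 1) i| / |fsolve p.1 p.2 i|) ^ (3 / 4 : ℝ))
      (6.12 * ((1 + σ) / σ) ^ (3 / 4 : ℝ)) := by
  have hm : Measurable fun p : (Fin n → Fin n → ℝ) × (Fin n → ℝ) =>
      (|p.2 j * fsolve p.1 (Pi.single j 1) i| / |fsolve p.1 p.2 i|) ^ (3 / 4 : ℝ) :=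
    (((measurable_rhs j).mul (measurable_sol_single i j)).abs.div
      (measurable_sol i).abs).pow_const _
  refine MeanLE.of_lintegral hm (fun p => by positivity) (by positivity) ?_
  refine lintegral_smoothed_le_of_rhs hm.ennreal_ofReal j fun L b => ?_
  have h := fun a => fsolve_of_rhs_eq_off L (b := Function.update b j 0)
    (b' := Function.update b j a) (j := j) (fun k hk => by
      rw [Function.update_of_ne hk, Function.update_of_ne hk]) i
  refine le_trans (le_of_eq (lintegral_congr fun a => ?_)) (lintegral_ratio_le hσ (hb j)
    (fsolve L (Pi.single j 1) i) (fsolve L (Function.update b j 0) i))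
  simp only [h a, Function.update_self, sub_zero]

theorem meanLE_entry_ratio (hσ : 0 < σ) (hL : ∀ i j, |Lbar i j| ≤ 1) (i : Fin n) {j k : Fin n}
    (hkj : k < j) :
    MeanLE (smoothedTriangular Lbar bbar σ)
      (fun p => (|p.1 j k * fsolve p.1 p.2 k * fsolve p.1 (Pi.single j 1) i| /
        |fsolve p.1 p.2 i|) ^ (3 / 4 : ℝ))
      (6.12 * ((1 + σ) / σ) ^ (3 / 4 : ℝ)) := by
  have hm : Measurable fun p : (Fin n → Fin n → ℝ) × (Fin n → ℝ) =>
      (|p.1 j k * fsolve p.1 p.2 k * fsolve p.1 (Pi.single j 1) i| /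
        |fsolve p.1 p.2 i|) ^ (3 / 4 : ℝ) :=
    ((((measurable_entry j k).mul (measurable_sol k)).mul (measurable_sol_single i j)).abs.div
      (measurable_sol i).abs).pow_const _
  refine MeanLE.of_lintegral hm (fun p => by positivity) (by positivity) ?_
  refine lintegral_smoothed_le_of_entry hm.ennreal_ofReal j k fun L b => ?_
  rw [triangularVariance, if_pos hkj.le]
  set L0 := Function.update L j (Function.update (L j) k 0)
  have hoff : ∀ a r s, ¬ (r = j ∧ s = k) →
      Function.update L j (Function.update (L j) k a) r s = L0 r s := by
    intro a r s hrs
    by_cases hr : r = j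
    · subst hr
      have hs : s ≠ k := fun h => hrs ⟨rfl, h⟩
      simp [L0, hs]
    · simp [L0, hr]
  have h0 : L0 j k = 0 := by simp [L0]
  have h1 := fun a => fsolve_of_entry_eq_off hkj (hoff a) b i
  have h2 := fun a => fsolve_of_entry_eq_off_of_lt hkj hkj (hoff a) b
  have h3 := fun a => fsolve_single_of_entry_eq_off hkj (hoff a) i
  have h := lintegral_ratio_le hσ (hL j k) (-(fsolve L0 b k * fsolve L0 (Pi.single j 1) i))
    (fsolve L0 b i)
  refine le_trans (le_of_eq (lintegral_congr fun a => ?_)) h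
  simp only [h1 a, h2 a, h3 a, h0, Function.update_self, sub_zero]
  rw [mul_neg, abs_neg, ← sub_eq_add_neg, mul_assoc]

theorem meanLE_sqrt_entry (hL : ∀ i j, |Lbar i j| ≤ 1) (j k : Fin n) :
    MeanLE (smoothedTriangular Lbar bbar σ) (fun p => √|p.1 j k|) (2 + σ ^ 2) := by
  have hm : Measurable fun p : (Fin n → Fin n → ℝ) × (Fin n → ℝ) => √|p.1 j k| :=
    (measurable_entry j k).abs.sqrt
  refine MeanLE.of_lintegral hm (fun p => Real.sqrt_nonneg _) (by positivity) ?_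
  refine lintegral_smoothed_le_of_entry hm.ennreal_ofReal j k fun L b => ?_
  simp only [Function.update_self]
  refine (lintegral_sqrt_abs_le (hL j k) _).trans (ENNReal.ofReal_le_ofReal ?_)
  rw [triangularVariance]
  split_ifs
  · rw [Real.coe_toNNReal _ (sq_nonneg σ)]
  · simpa using sq_nonneg σ

theorem meanLE_sqrt_rhs (hb : ∀ i, |bbar i| ≤ 1) (j : Fin n) :
    MeanLE (smoothedTriangular Lbar bbar σ) (fun p => √|p.2 j|) (2 + σ ^ 2) := by
  have hm : Measurable fun p : (Fin n → Fin n → ℝ) × (Fin n → ℝ) => √|p.2 j| :=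
    (measurable_rhs j).abs.sqrt
  refine MeanLE.of_lintegral hm (fun p => Real.sqrt_nonneg _) (by positivity) ?_
  refine lintegral_smoothed_le_of_rhs hm.ennreal_ofReal j fun L b => ?_
  simp only [Function.update_self]
  refine (lintegral_sqrt_abs_le (hb j) _).trans (ENNReal.ofReal_le_ofReal ?_)
  rw [Real.coe_toNNReal _ (sq_nonneg σ)]

theorem meanLE_sqrt_inv_diag (hσ : 0 < σ) (i : Fin n) :
    MeanLE (smoothedTriangular Lbar bbar σ) (fun p => √(|p.1 i i|⁻¹)) (1 + 2 / σ) := by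
  have hm : Measurable fun p : (Fin n → Fin n → ℝ) × (Fin n → ℝ) => √(|p.1 i i|⁻¹) :=
    (measurable_entry i i).abs.inv.sqrt
  refine MeanLE.of_lintegral hm (fun p => Real.sqrt_nonneg _) (by positivity) ?_
  refine lintegral_smoothed_le_of_entry hm.ennreal_ofReal i i fun L b => ?_
  rw [triangularVariance, if_pos le_rfl]
  simp only [Function.update_self]
  simpa using lintegral_sqrt_inv_abs_add_le hσ (Lbar i i) 0

theorem meanLE_sqrt_inv_fsolveNum (hσ : 0 < σ) (i : Fin n) :
    MeanLE (smoothedTriangular Lbar bbar σ) (fun p => √(|fsolveNum p.1 p.2 i|⁻¹)) (1 + 2 / σ) := by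
  have hm : Measurable fun p : (Fin n → Fin n → ℝ) × (Fin n → ℝ) => √(|fsolveNum p.1 p.2 i|⁻¹) :=
    (measurable_fsolveNum i).abs.inv.sqrt
  refine MeanLE.of_lintegral hm (fun p => Real.sqrt_nonneg _) (by positivity) ?_
  refine lintegral_smoothed_le_of_rhs hm.ennreal_ofReal i fun L b => ?_
  simp only [fsolveNum_update]
  exact lintegral_sqrt_inv_abs_add_le hσ (bbar i) _

end Smoothed

/-! ### Elementary inequalities -/

theorem rpow_sum_le_sum_rpow {ι : Type*} (s : Finset ι) {f : ι → ℝ} (hf : ∀ i ∈ s, 0 ≤ f i)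
    {p : ℝ} (hp : 0 < p) (hp1 : p ≤ 1) : (∑ i ∈ s, f i) ^ p ≤ ∑ i ∈ s, f i ^ p := by
  refine Finset.le_sum_of_subadditive_on_pred (fun x : ℝ => x ^ p) (fun x => 0 ≤ x) ?_ ?_ ?_ f hf
  · rw [Real.zero_rpow hp.ne']
  · intro x y hx hy
    have := NNReal.rpow_add_le_add_rpow ⟨x, hx⟩ ⟨y, hy⟩ hp.le hp1
    exact_mod_cast this
  · exact fun x y hx hy => add_nonneg hx hy

theorem rpow_add_le_add_rpow_of_nonneg {x y p : ℝ} (hx : 0 ≤ x) (hy : 0 ≤ y) (hp : 0 ≤ p)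
    (hp1 : p ≤ 1) : (x + y) ^ p ≤ x ^ p + y ^ p := by
  have := NNReal.rpow_add_le_add_rpow ⟨x, hx⟩ ⟨y, hy⟩ hp hp1
  exact_mod_cast this

theorem sqrt_add_le_sqrt_add_sqrt {x y : ℝ} (hx : 0 ≤ x) (hy : 0 ≤ y) : √(x + y) ≤ √x + √y := by
  simp only [Real.sqrt_eq_rpow]
  exact rpow_add_le_add_rpow_of_nonneg hx hy (by norm_num) (by norm_num)

theorem sqrt_sum_le_sum_sqrt {ι : Type*} (s : Finset ι) {f : ι → ℝ} (hf : ∀ i ∈ s, 0 ≤ f i) :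
    √(∑ i ∈ s, f i) ≤ ∑ i ∈ s, √(f i) := by
  simp only [Real.sqrt_eq_rpow]
  exact rpow_sum_le_sum_rpow s hf (by norm_num) (by norm_num)

/-- The tangent to the logarithm at `m`. Choosing `m` as a bound for the mean of `u` and integrating
gives Jensen's inequality. -/
theorem log_le_div_sub_one_add_log {u m : ℝ} (hu : 0 < u) (hm : 0 < m) :
    Real.log u ≤ u / m - 1 + Real.log m := by
  have := Real.log_le_sub_one_of_pos (div_pos hu hm)
  rw [Real.log_div hu.ne' hm.ne'] at this
  linarith

theorem sum_fin_range_add (n : ℕ) (A : ℝ) :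
    ∑ j ∈ Finset.range n, (A + j * A) = A * (n * (n + 1) / 2) := by
  induction n with
  | zero => simp
  | succ n ih =>
    rw [Finset.sum_range_succ, ih]
    push_cast
    ring

/-- The sum has `n(n+1)(n+2)/6` terms in all, and `n^3/2` exceeds this by `n(n-2)(2n+1)/6`. -/
theorem sum_triangle_le {n : ℕ} (hn : 2 ≤ n) {A : ℝ} (hA : 0 ≤ A) :
    ∑ i : Fin n, ∑ j ∈ Finset.Iic i, (A + ∑ _k ∈ Finset.Iio j, A) ≤ n ^ 3 / 2 * A := by
  have h1 : ∀ i : Fin n, ∑ j ∈ Finset.Iic i, (A + ∑ _k ∈ Finset.Iio j, A) =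
      A * ((i.val + 1) * (i.val + 2) / 2) := by
    intro i
    simp only [Finset.sum_const, Fin.card_Iio, nsmul_eq_mul]
    rw [← Finset.add_sum_Iio_eq_sum_Iic (f := fun j : Fin n => A + (j.val : ℝ) * A),
      ← sum_fin_val_eq_sum_Iio i (fun j : Fin n => A + (j.val : ℝ) * A),
      Fin.sum_univ_eq_sum_range (fun j : ℕ => A + (j : ℝ) * A) i.val, sum_fin_range_add]
    ring
  have h2 : ∀ m : ℕ, ∑ i ∈ Finset.range m, A * (((i : ℝ) + 1) * (i + 2) / 2) =
      A * (m * (m + 1) * (m + 2) / 6) := by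
    intro m
    induction m with
    | zero => simp
    | succ m ih =>
      rw [Finset.sum_range_succ, ih]
      push_cast
      ring
  rw [Finset.sum_congr rfl fun i _ => h1 i,
    Fin.sum_univ_eq_sum_range (fun i : ℕ => A * (((i : ℝ) + 1) * (i + 2) / 2)) n, h2, mul_comm]
  refine mul_le_mul_of_nonneg_right ?_ hA
  have hn' : (2 : ℝ) ≤ n := by exact_mod_cast hn
  have : 0 ≤ (n : ℝ) * (n - 2) * (2 * n + 1) :=
    mul_nonneg (mul_nonneg (by linarith) (by linarith)) (by linarith)
  nlinarith

/-! ### A pointwise bound for the loss of precision -/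

section Pointwise

variable {n : ℕ}

/-- The sum of the powers of order `3 / 4` of all sensitivities of the solution to the data. -/
noncomputable def sensitivitySum (L : Fin n → Fin n → ℝ) (b : Fin n → ℝ) : ℝ :=
  ∑ i, ∑ j ∈ Finset.Iic i,
    ((|b j * fsolve L (Pi.single j 1) i| / |fsolve L b i|) ^ (3 / 4 : ℝ) +
      ∑ k ∈ Finset.Iio j, (|L j k * fsolve L b k * fsolve L (Pi.single j 1) i| /
        |fsolve L b i|) ^ (3 / 4 : ℝ))

/-- A bound for the square root of the size of the data. -/
noncomputable def rootSizeSum (L : Fin n → Fin n → ℝ) (b : Fin n → ℝ) : ℝ :=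
  1 + ∑ i, ∑ j, √|L i j| + ∑ i, √|b i| + ∑ i, √(|L i i|⁻¹)

/-- The sum of the square roots of the inverses of the numerators in forward substitution. -/
noncomputable def rootInvNumSum (L : Fin n → Fin n → ℝ) (b : Fin n → ℝ) : ℝ :=
  ∑ i, √(|fsolveNum L b i|⁻¹)

theorem sensitivitySum_nonneg (L : Fin n → Fin n → ℝ) (b : Fin n → ℝ) :
    0 ≤ sensitivitySum L b := by
  unfold sensitivitySum
  positivity

/-- Subadditivity of the power `3 / 4`. Summing over all rows also takes care of the maximum over
`i` in the relative error. -/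
theorem rpow_sensitivity_le_sensitivitySum (L : Fin n → Fin n → ℝ) (b : Fin n → ℝ) (i : Fin n) :
    ((∑ j ∈ Finset.Iic i, (|b j * fsolve L (Pi.single j 1) i| +
        ∑ k ∈ Finset.Iio j, |L j k * fsolve L b k * fsolve L (Pi.single j 1) i|)) /
          |fsolve L b i|) ^ (3 / 4 : ℝ) ≤ sensitivitySum L b := by
  have hp : (0 : ℝ) < 3 / 4 := by norm_num
  have hp1 : (3 / 4 : ℝ) ≤ 1 := by norm_num
  simp only [Finset.sum_div, add_div]
  refine (rpow_sum_le_sum_rpow _ (fun j _ => by positivity) hp hp1).trans ?_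
  refine le_trans (Finset.sum_le_sum fun j _ => ?_) (Finset.single_le_sum
    (f := fun i => ∑ j ∈ Finset.Iic i,
      ((|b j * fsolve L (Pi.single j 1) i| / |fsolve L b i|) ^ (3 / 4 : ℝ) +
      ∑ k ∈ Finset.Iio j, (|L j k * fsolve L b k * fsolve L (Pi.single j 1) i| /
        |fsolve L b i|) ^ (3 / 4 : ℝ))) (fun i _ => by positivity) (Finset.mem_univ i))
  refine (rpow_add_le_add_rpow_of_nonneg (by positivity) (by positivity) hp.le hp1).trans ?_
  gcongr
  exact rpow_sum_le_sum_rpow _ (fun k _ => by positivity) hp hp1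

theorem log_one_add_pow_mul_le {t u : ℝ} (ht : 0 ≤ t) (hu : 0 ≤ u) (d : ℕ) :
    Real.log (1 + t ^ d * u) ≤ d * (2 * √t) + 2 * √u := by
  have h1 : 1 + t ^ d * u ≤ (1 + t) ^ d * (1 + u) := by
    have h2 : t ^ d ≤ (1 + t) ^ d := pow_le_pow_left₀ ht (by linarith) d
    have h3 : 1 ≤ (1 + t) ^ d := one_le_pow₀ (by linarith)
    nlinarith
  calc Real.log (1 + t ^ d * u) ≤ Real.log ((1 + t) ^ d * (1 + u)) :=
        Real.log_le_log (by positivity) h1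
    _ = d * Real.log (1 + t) + Real.log (1 + u) := by
      rw [Real.log_mul (by positivity) (by positivity), Real.log_pow]
    _ ≤ _ := by
      gcongr
      · exact log_one_add_le_two_mul_sqrt ht
      · exact log_one_add_le_two_mul_sqrt hu

theorem log_one_add_mul_le {w y s m : ℝ} (hw : 0 ≤ w) (hy : 0 ≤ y) (hm : 0 < m)
    (h : y ^ (3 / 4 : ℝ) ≤ s) :
    Real.log (1 + w * y) ≤ 4 / 3 * ((1 + w ^ (3 / 4 : ℝ) * s) / m - 1 + Real.log m) := by
  have h0 : 0 < 1 + w * y := by positivity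
  have h1 : (1 + w * y) ^ (3 / 4 : ℝ) ≤ 1 + w ^ (3 / 4 : ℝ) * s := by
    refine (rpow_add_le_add_rpow_of_nonneg zero_le_one (by positivity) (by norm_num)
      (by norm_num)).trans ?_
    rw [Real.one_rpow, Real.mul_rpow hw hy]
    gcongr
  have h2 : 0 < (1 + w * y) ^ (3 / 4 : ℝ) := by positivity
  have h3 := (Real.log_le_log h2 h1).trans (log_le_div_sub_one_add_log (h2.trans_le h1) hm)
  rw [Real.log_rpow h0] at h3
  linarith

/-- The exponent in the bound for the relative error. -/
noncomputable def lossBound (w m η : ℝ) (L : Fin n → Fin n → ℝ) (b : Fin n → ℝ) : ℝ :=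
  4 / 3 * ((1 + w ^ (3 / 4 : ℝ) * sensitivitySum L b) / m - 1 + Real.log m) +
    ((6 * n + 2) * (2 * √η) * rootSizeSum L b +
      2 * √(η * (w ^ 2 * n * (8 ^ n) ^ 3)) * rootInvNumSum L b)

/-- Because of the summands `1` inside the logarithms, the bound also dominates the positive part of
the loss, which is what is integrated. -/
theorem lossBound_nonneg {w m η : ℝ} (hw : 0 ≤ w) (hm : 0 < m) (L : Fin n → Fin n → ℝ)
    (b : Fin n → ℝ) : 0 ≤ lossBound w m η L b := by
  have h0 := sensitivitySum_nonneg L b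
  have h1 : 1 ≤ 1 + w ^ (3 / 4 : ℝ) * sensitivitySum L b := by
    have : 0 ≤ w ^ (3 / 4 : ℝ) * sensitivitySum L b := by positivity
    linarith
  have h2 := (Real.log_nonneg h1).trans
    (log_le_div_sub_one_add_log (zero_lt_one.trans_le h1) hm)
  have h3 : 0 ≤ rootSizeSum L b := by
    unfold rootSizeSum
    positivity
  have h4 : 0 ≤ rootInvNumSum L b := by
    unfold rootInvNumSum
    positivity
  unfold lossBound
  positivity

/-- Relative to `ε |x_i|`, the first order part is `w S / |x_i|` and the remainder is at most some
`Z`. Their sum is at most `(1 + w S / |x_i|) (1 + Z)`, so the two logarithms can be estimated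
separately. -/
theorem forwardSubst_error_le_exp {ε : ℝ} (hε : 0 < ε) (M : FinitePrecision ε)
    (T : SummationScheme n) {L : Fin n → Fin n → ℝ} {b : Fin n → ℝ} (hL : ∀ i, L i i ≠ 0)
    (hnum : ∀ i, fsolveNum L b i ≠ 0) {w : ℝ} (hw1 : 1 ≤ w)
    (hw : (1 + ε) ^ (4 + Nat.clog 2 (n - 1)) - 1 ≤ (w - 1) * ε) (hw2 : (w - 1) * ε ≤ 1 / 2)
    {m : ℝ} (hm : 0 < m) {η : ℝ} (hη : 0 < η) (hηε : η ^ (6 * n + 3) = ε) (i : Fin n) :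
    |forwardSubst M T (Matrix.of L) b i - fsolve L b i| ≤
      ε * Real.exp (lossBound w m η L b) * |fsolve L b i| := by
  set H := 1 + ∑ i, ∑ j, |L i j| + ∑ i, |b i| + ∑ i, |L i i|⁻¹ with hHdef
  have p1 : 0 ≤ ∑ i, ∑ j, |L i j| := by positivity
  have p2 : 0 ≤ ∑ i, |b i| := by positivity
  have p3 : 0 ≤ ∑ i, |L i i|⁻¹ := by positivity
  have hH1 : 1 ≤ H := by linarith
  have hHb : ∀ i, |b i| ≤ H := fun i => by
    have := Finset.single_le_sum (f := fun i => |b i|) (fun _ _ => abs_nonneg _)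
      (Finset.mem_univ i)
    linarith
  have hHinv : ∀ i, |L i i|⁻¹ ≤ H := fun i => by
    have := Finset.single_le_sum (f := fun i => |L i i|⁻¹) (fun _ _ => by positivity)
      (Finset.mem_univ i)
    linarith
  have hHrow : ∀ i, ∑ k ∈ Finset.Iic i, |L i k| ≤ H := fun i => by
    have h1 := Finset.single_le_sum (f := fun i => ∑ j, |L i j|) (fun _ _ => by positivity)
      (Finset.mem_univ i)
    have h2 : ∑ k ∈ Finset.Iic i, |L i k| ≤ ∑ k, |L i k| :=
      Finset.sum_le_sum_of_subset_of_nonneg (Finset.subset_univ _) fun _ _ _ => abs_nonneg _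
    linarith
  have hHdiag : |L i i| ≤ H :=
    (Finset.single_le_sum (f := fun k => |L i k|) (fun _ _ => abs_nonneg _)
      (Finset.mem_Iic.2 le_rfl)).trans (hHrow i)
  have hroot : √H ≤ rootSizeSum L b := by
    rw [hHdef, rootSizeSum]
    refine (sqrt_add_le_sqrt_add_sqrt (by positivity) p3).trans (add_le_add ?_
      (sqrt_sum_le_sum_sqrt _ fun _ _ => by positivity))
    refine (sqrt_add_le_sqrt_add_sqrt (by positivity) p2).trans (add_le_add ?_
      (sqrt_sum_le_sum_sqrt _ fun _ _ => by positivity))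
    refine (sqrt_add_le_sqrt_add_sqrt zero_le_one p1).trans (add_le_add (by simp) ?_)
    refine (sqrt_sum_le_sum_sqrt _ fun _ _ => by positivity).trans (Finset.sum_le_sum fun i _ => ?_)
    exact sqrt_sum_le_sum_sqrt _ fun _ _ => by positivity
  have herr := forwardSubst_error hε.le M T L b hL hw hw2 hH1 hHb hHrow hHinv i
  have hsens := rpow_sensitivity_le_sensitivitySum L b i
  set x := fsolve L b i with hx
  set S := ∑ j ∈ Finset.Iic i, (|b j * fsolve L (Pi.single j 1) i| +
        ∑ k ∈ Finset.Iio j, |L j k * fsolve L b k * fsolve L (Pi.single j 1) i|)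
  have hS : 0 ≤ S := by positivity
  set V := |fsolveNum L b i|⁻¹
  have hV : 0 ≤ V := by positivity
  have hVsum : √V ≤ rootInvNumSum L b :=
    Finset.single_le_sum (f := fun i => √(|fsolveNum L b i|⁻¹)) (fun _ _ => Real.sqrt_nonneg _)
      (Finset.mem_univ i)
  have hxV : |x|⁻¹ = |L i i| * V := by
    rw [hx, fsolve_eq, abs_div, inv_div, div_eq_mul_inv]
    rfl
  have hx0 : 0 < |x| := by
    have := abs_pos.2 (hnum i)
    have h2 := abs_pos.2 (hL i)
    rw [← inv_pos, hxV]
    positivity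
  set C : ℝ := w ^ 2 * n * (8 ^ n) ^ 3
  have hC : 0 ≤ C := by positivity
  -- One spare factor `ε = η^(6n+3)` is distributed: `6n + 1` powers of `H` come from the crude
  -- remainder, one more from `1 / |x_i| = |L i i| V` with `|L i i| ≤ H`, and the last `η` goes with
  -- `V`.
  have hε2 : (w - 1) * ε * (ε + (w - 1) * ε) * (n * H * ((8 * H ^ 2) ^ n) ^ 3) ≤
      ε * ((η * H) ^ (6 * n + 2) * (η * (C * V))) * |x| := by
    have e1 : (w - 1) * ε * (ε + (w - 1) * ε) ≤ ε * (ε * w ^ 2) := by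
      have : 0 ≤ ε ^ 2 * w := by positivity
      nlinarith
    have e2 : V * |x| * |L i i| = 1 := by
      rw [mul_right_comm, mul_comm V, ← hxV, inv_mul_cancel₀ hx0.ne']
    have e3 : 1 ≤ V * |x| * H := by
      rw [← e2]
      gcongr
    calc _ ≤ ε * (ε * w ^ 2) * (n * H * ((8 * H ^ 2) ^ n) ^ 3) := by gcongr
      _ = ε * (ε * w ^ 2) * (n * H * ((8 * H ^ 2) ^ n) ^ 3) * 1 := by ring
      _ ≤ ε * (ε * w ^ 2) * (n * H * ((8 * H ^ 2) ^ n) ^ 3) * (V * |x| * H) := by gcongr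
      _ = ε * (η ^ (6 * n + 3) * w ^ 2) * (n * H * ((8 * H ^ 2) ^ n) ^ 3) * (V * |x| * H) := by
        rw [hηε]
      _ = _ := by
        simp only [C]
        rw [mul_pow 8 (H ^ 2) n, ← pow_mul, mul_pow, ← pow_mul H, mul_pow η]
        have : 2 * n * 3 = 6 * n := by ring
        rw [this]
        ring
  set Z := (η * H) ^ (6 * n + 2) * (η * (C * V))
  have hZ : 0 ≤ Z := by positivity
  have hlogZ : Real.log (1 + Z) ≤ (6 * n + 2) * (2 * √η) * rootSizeSum L b +
      2 * √(η * C) * rootInvNumSum L b := by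
    refine (log_one_add_pow_mul_le (by positivity) (by positivity) _).trans ?_
    rw [← mul_assoc η C V, Real.sqrt_mul hη.le H, Real.sqrt_mul (by positivity) V]
    push_cast
    calc _ = (6 * n + 2) * (2 * √η) * √H + 2 * √(η * C) * √V := by ring
      _ ≤ _ := by gcongr
  have hlogS := log_one_add_mul_le (w := w) (by linarith) (div_nonneg hS hx0.le) hm hsens
  have hle : w * (S / |x|) + Z ≤ Real.exp (lossBound w m η L b) := by
    have q : 0 ≤ w * (S / |x|) := by positivity
    calc w * (S / |x|) + Z ≤ (1 + w * (S / |x|)) * (1 + Z) := by nlinarith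
      _ = Real.exp (Real.log (1 + w * (S / |x|)) + Real.log (1 + Z)) := by
        rw [Real.exp_add, Real.exp_log (by positivity), Real.exp_log (by positivity)]
      _ ≤ _ := Real.exp_le_exp.2 (add_le_add hlogS hlogZ)
  calc _ ≤ (ε + (w - 1) * ε) * S +
        (w - 1) * ε * (ε + (w - 1) * ε) * (n * H * ((8 * H ^ 2) ^ n) ^ 3) := herr
    _ ≤ (ε + (w - 1) * ε) * S + ε * Z * |x| := by gcongr
    _ = ε * (w * (S / |x|) + Z) * |x| := by
      field_simp
      ring
    _ ≤ _ := by gcongr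

theorem log10_ofReal_inv {x : ℝ} (hx : 0 < x) :
    log10 (ENNReal.ofReal x)⁻¹ = ((-Real.log x / Real.log 10 : ℝ) : EReal) := by
  rw [log10, ENNReal.log_inv, ENNReal.log_ofReal_of_pos hx, EReal.coe_div, EReal.coe_neg]

theorem lossOfPrecision_le {ε : ℝ} (hε : 0 < ε) (M : FinitePrecision ε) (T : SummationScheme n)
    {L : Fin n → Fin n → ℝ} {b : Fin n → ℝ} (hlow : ∀ i j, i < j → L i j = 0)
    (hL : ∀ i, L i i ≠ 0) {r : ℝ}
    (h : ∀ i, |forwardSubst M T (Matrix.of L) b i - fsolve L b i| ≤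
      ε * Real.exp r * |fsolve L b i|) :
    lossOfPrecision M T (Matrix.of L) b ≤ ((r / Real.log 10 : ℝ) : EReal) := by
  have hRE : vecRelError (forwardSubst M T (Matrix.of L) b) ((Matrix.of L)⁻¹ *ᵥ b) ≤
      ENNReal.ofReal (ε * Real.exp r) := by
    rw [inv_mulVec_eq_fsolve hlow hL]
    refine iSup_le fun i => ENNReal.div_le_of_le_mul ?_
    rw [← ENNReal.ofReal_mul (by positivity)]
    exact ENNReal.ofReal_le_ofReal (h i)
  rw [lossOfPrecision, if_neg (det_ne_zero_of_lower hlow hL)]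
  refine (EReal.sub_le_sub le_rfl (log10_monotone (ENNReal.inv_le_inv.2 hRE))).trans ?_
  rw [log10_ofReal_inv hε, log10_ofReal_inv (by positivity), ← EReal.coe_sub, EReal.coe_le_coe_iff,
    Real.log_mul hε.ne' (Real.exp_pos r).ne', Real.log_exp]
  apply le_of_eq
  ring

end Pointwise

/-! ### The expected loss of precision -/

section Expectation

variable {n : ℕ} {Lbar : Matrix (Fin n) (Fin n) ℝ} {bbar : Fin n → ℝ} {σ : ℝ}

theorem meanLE_sensitivitySum (hn : 2 ≤ n) (hσ : 0 < σ) (hL : ∀ i j, |Lbar i j| ≤ 1)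
    (hb : ∀ i, |bbar i| ≤ 1) :
    MeanLE (smoothedTriangular Lbar bbar σ) (fun p => sensitivitySum p.1 p.2)
      (n ^ 3 / 2 * (6.12 * ((1 + σ) / σ) ^ (3 / 4 : ℝ))) := by
  have h : MeanLE (smoothedTriangular Lbar bbar σ) (fun p => sensitivitySum p.1 p.2) _ :=
    MeanLE.sum _ fun i _ => MeanLE.sum _ fun j _ => (meanLE_rhs_ratio hσ hb i j).add
      (MeanLE.sum _ fun k hk => meanLE_entry_ratio hσ hL i (Finset.mem_Iio.1 hk))
  exact ⟨h.1, h.2.trans (sum_triangle_le hn (by positivity))⟩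

/-- A bound for the mean of `rootSizeSum`. -/
noncomputable def rootSizeBound (n : ℕ) (σ : ℝ) : ℝ :=
  1 + ∑ _i : Fin n, ∑ _j : Fin n, (2 + σ ^ 2) + ∑ _i : Fin n, (2 + σ ^ 2) +
    ∑ _i : Fin n, (1 + 2 / σ)

theorem meanLE_rootSizeSum (hσ : 0 < σ) (hL : ∀ i j, |Lbar i j| ≤ 1)
    (hb : ∀ i, |bbar i| ≤ 1) :
    MeanLE (smoothedTriangular Lbar bbar σ) (fun p => rootSizeSum p.1 p.2) (rootSizeBound n σ) :=
  (((MeanLE.const 1).add (MeanLE.sum _ fun i _ => MeanLE.sum _ fun j _ =>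
    meanLE_sqrt_entry hL i j)).add (MeanLE.sum _ fun i _ => meanLE_sqrt_rhs hb i)).add
    (MeanLE.sum _ fun i _ => meanLE_sqrt_inv_diag hσ i)

theorem meanLE_rootInvNumSum (hσ : 0 < σ) :
    MeanLE (smoothedTriangular Lbar bbar σ) (fun p => rootInvNumSum p.1 p.2)
      (∑ _i : Fin n, (1 + 2 / σ)) :=
  MeanLE.sum _ fun i _ => meanLE_sqrt_inv_fsolveNum hσ i

/-- The part of the bound for the loss of precision that vanishes with the precision. -/
noncomputable def lossRemainder (n : ℕ) (σ w η : ℝ) : ℝ :=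
  ((6 * n + 2) * (2 * √η) * rootSizeBound n σ +
    2 * √(η * (w ^ 2 * n * (8 ^ n) ^ 3)) * ∑ _i : Fin n, (1 + 2 / σ)) / Real.log 10

theorem lossRemainder_nonneg (n : ℕ) {σ : ℝ} (hσ : 0 < σ) (w η : ℝ) :
    0 ≤ lossRemainder n σ w η := by
  have h10 : 0 < Real.log 10 := Real.log_pos (by norm_num)
  unfold lossRemainder rootSizeBound
  positivity

theorem meanLE_lossBound (hn : 2 ≤ n) (hσ : 0 < σ) (hL : ∀ i j, |Lbar i j| ≤ 1)
    (hb : ∀ i, |bbar i| ≤ 1) {w : ℝ} (hw : 0 ≤ w) (η : ℝ) {m : ℝ}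
    (hm : m = 1 + w ^ (3 / 4 : ℝ) * (n ^ 3 / 2 * (6.12 * ((1 + σ) / σ) ^ (3 / 4 : ℝ)))) :
    MeanLE (smoothedTriangular Lbar bbar σ)
      (fun p => lossBound w m η p.1 p.2 / Real.log 10)
      (4 / 3 * Real.log m / Real.log 10 + lossRemainder n σ w η) := by
  have hm0 : 0 < m := by
    rw [hm]
    positivity
  have h10 : 0 < Real.log 10 := Real.log_pos (by norm_num)
  have h1 := (((((meanLE_sensitivitySum hn hσ hL hb).const_mul
    (show 0 ≤ 4 / 3 * w ^ (3 / 4 : ℝ) / m by positivity)).add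
    (MeanLE.const (4 / 3 * (1 / m - 1 + Real.log m)))).add
    (((meanLE_rootSizeSum hσ hL hb).const_mul
      (show 0 ≤ (6 * (n : ℝ) + 2) * (2 * √η) by positivity)).add
    ((meanLE_rootInvNumSum (Lbar := Lbar) (bbar := bbar) hσ).const_mul
      (show 0 ≤ 2 * √(η * (w ^ 2 * n * (8 ^ n) ^ 3)) by positivity))))).const_mul
    (show 0 ≤ (Real.log 10)⁻¹ by positivity)
  convert h1 using 1
  · funext p
    rw [lossBound]
    ring
  · set q := w ^ (3 / 4 : ℝ) * (n ^ 3 / 2 * (6.12 * ((1 + σ) / σ) ^ (3 / 4 : ℝ)))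
    -- By the choice of `m` the tangent is taken at the bound `1 + q` for the mean, so the linear
    -- part vanishes.
    have h2 : 4 / 3 * w ^ (3 / 4 : ℝ) / m *
        (n ^ 3 / 2 * (6.12 * ((1 + σ) / σ) ^ (3 / 4 : ℝ))) +
        4 / 3 * (1 / m - 1 + Real.log m) = 4 / 3 * Real.log m := by
      calc _ = 4 / 3 * ((1 + q) / m - 1 + Real.log m) := by
            simp only [q]
            ring
        _ = _ := by
          rw [← hm, div_self hm0.ne']
          ring
    rw [h2, lossRemainder]
    ring

theorem lintegral_lossOfPrecision_le (hn : 2 ≤ n) (hσ : 0 < σ) {ε : ℝ} (hε : 0 < ε)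
    (M : FinitePrecision ε) (T : SummationScheme n) (h0 : ∀ i j, i < j → Lbar i j = 0)
    (hL : ∀ i j, |Lbar i j| ≤ 1) (hb : ∀ i, |bbar i| ≤ 1) {w : ℝ} (hw1 : 1 ≤ w)
    (hw : (1 + ε) ^ (4 + Nat.clog 2 (n - 1)) - 1 ≤ (w - 1) * ε) (hw2 : (w - 1) * ε ≤ 1 / 2)
    {m : ℝ} (hm : m = 1 + w ^ (3 / 4 : ℝ) * (n ^ 3 / 2 * (6.12 * ((1 + σ) / σ) ^ (3 / 4 : ℝ)))) :
    ∫⁻ p, (lossOfPrecision M T (Matrix.of p.1) p.2).toENNReal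
        ∂(smoothedTriangular Lbar bbar σ) ≤
      ENNReal.ofReal (4 / 3 * Real.log m / Real.log 10 +
        lossRemainder n σ w (ε ^ ((6 * n + 3 : ℕ) : ℝ)⁻¹)) := by
  have hm0 : 0 < m := by
    rw [hm]
    positivity
  have h10 : 0 < Real.log 10 := Real.log_pos (by norm_num)
  set η := ε ^ ((6 * n + 3 : ℕ) : ℝ)⁻¹
  have hη : 0 < η := Real.rpow_pos_of_pos hε _
  have hηε : η ^ (6 * n + 3) = ε := Real.rpow_inv_natCast_pow hε.le (by omega)
  refine le_trans (lintegral_mono_ae ?_)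
    ((meanLE_lossBound hn hσ hL hb (by linarith) η hm).lintegral_le fun p =>
      div_nonneg (lossBound_nonneg (by linarith) hm0 _ _) h10.le)
  filter_upwards [ae_lower h0, ae_diag_ne_zero hσ, ae_fsolveNum_ne_zero hσ] with p h1 h2 h3
  exact EReal.toENNReal_le_toENNReal (lossOfPrecision_le hε M T h1 h2
    (forwardSubst_error_le_exp hε M T h2 h3 hw1 hw hw2 hm0 hη hηε))

end Expectation

/-! ### Numerical constants -/

/-- Since `n ≥ 2`, `28 n^5 ≥ 56 n^4`, and `56^(3/4) ≥ 20.4` exceeds `11^(3/4) * 3.06` by enough to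
absorb the summand `1`. Finally `28^20 ≤ 10^29` gives `log₁₀ 28 ≤ 1.45`. -/
theorem log_le_of_budget {n : ℕ} (hn : 2 ≤ n) {σ ℓ m : ℝ} (hσ : 0 < σ) (hℓ : 1 ≤ ℓ)
    (hm : m = 1 + (11 * ℓ) ^ (3 / 4 : ℝ) *
      (n ^ 3 / 2 * (6.12 * ((1 + σ) / σ) ^ (3 / 4 : ℝ)))) :
    4 / 3 * Real.log m / Real.log 10 ≤
      Real.logb 10 ((1 + σ) / σ) + 5 * Real.logb 10 n + Real.logb 10 ℓ + 1.452 := by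
  have hκ : 1 ≤ (1 + σ) / σ := by
    rw [one_le_div hσ]
    linarith
  set κ := (1 + σ) / σ
  have hκ0 : 0 < κ := by linarith
  have hℓ0 : 0 < ℓ := by linarith
  have hn' : (2 : ℝ) ≤ n := by exact_mod_cast hn
  have hn0 : (0 : ℝ) < n := by linarith
  have h10 : 0 < Real.log 10 := Real.log_pos (by norm_num)
  have hm0 : 0 < m := by
    rw [hm]
    positivity
  have hbudget : m ≤ (28 * n ^ 5 * ℓ * κ) ^ (3 / 4 : ℝ) := by
    have e11 : (11 : ℝ) ^ (3 / 4 : ℝ) ≤ 6.05 := by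
      rw [← Real.rpow_le_rpow_iff (z := 4) (by positivity) (by norm_num) (by norm_num),
        ← Real.rpow_mul (by norm_num)]
      norm_num
    have e56 : 20.4 ≤ (56 : ℝ) ^ (3 / 4 : ℝ) := by
      rw [← Real.rpow_le_rpow_iff (z := 4) (by norm_num) (by positivity) (by norm_num),
        ← Real.rpow_mul (by norm_num)]
      norm_num
    have hu : 1 ≤ ℓ ^ (3 / 4 : ℝ) * κ ^ (3 / 4 : ℝ) :=
      one_le_mul_of_one_le_of_one_le (Real.one_le_rpow hℓ (by norm_num))
        (Real.one_le_rpow hκ (by norm_num))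
    have hn3 : (8 : ℝ) ≤ n ^ 3 := by
      calc (8 : ℝ) = 2 ^ 3 := by norm_num
        _ ≤ n ^ 3 := by gcongr
    have h1 : (56 * n ^ 4 * ℓ * κ) ^ (3 / 4 : ℝ) ≤ (28 * n ^ 5 * ℓ * κ) ^ (3 / 4 : ℝ) := by
      have h : 56 * (n : ℝ) ^ 4 ≤ 28 * (n : ℝ) ^ 5 := by
        have : 0 ≤ (n : ℝ) ^ 4 := by positivity
        nlinarith
      gcongr
    have h2 : (56 * n ^ 4 * ℓ * κ) ^ (3 / 4 : ℝ) =
        (56 : ℝ) ^ (3 / 4 : ℝ) * n ^ 3 * (ℓ ^ (3 / 4 : ℝ) * κ ^ (3 / 4 : ℝ)) := by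
      rw [Real.mul_rpow (by positivity) hκ0.le, Real.mul_rpow (by positivity) hℓ0.le,
        Real.mul_rpow (by norm_num) (by positivity), ← Real.rpow_natCast_mul hn0.le]
      norm_num
      ring
    refine le_trans ?_ (h2.symm.trans_le h1)
    rw [hm, Real.mul_rpow (by norm_num) hℓ0.le]
    set u := ℓ ^ (3 / 4 : ℝ) * κ ^ (3 / 4 : ℝ) with hudef
    have hnu : 8 ≤ (n : ℝ) ^ 3 * u := by nlinarith
    calc 1 + 11 ^ (3 / 4 : ℝ) * ℓ ^ (3 / 4 : ℝ) * (n ^ 3 / 2 * (6.12 * κ ^ (3 / 4 : ℝ)))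
        = 1 + 11 ^ (3 / 4 : ℝ) * (3.06 * (n ^ 3 * u)) := by
          rw [hudef]
          ring
      _ ≤ 1 + 6.05 * (3.06 * (n ^ 3 * u)) := by gcongr
      _ ≤ 20.4 * (n ^ 3 * u) := by linarith
      _ ≤ 56 ^ (3 / 4 : ℝ) * (n ^ 3 * u) := by gcongr
      _ = _ := by ring
  have hlog28 : Real.log 28 ≤ 1.452 * Real.log 10 := by
    have h1 : Real.log ((28 : ℝ) ^ 20) ≤ Real.log ((10 : ℝ) ^ 29) :=
      Real.log_le_log (by norm_num) (by norm_num)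
    rw [Real.log_pow, Real.log_pow] at h1
    push_cast at h1
    linarith
  have hlog : Real.log m ≤ 3 / 4 * (Real.log 28 + 5 * Real.log n + Real.log ℓ + Real.log κ) := by
    refine (Real.log_le_log hm0 hbudget).trans_eq ?_
    rw [Real.log_rpow (by positivity), Real.log_mul (by positivity) hκ0.ne',
      Real.log_mul (by positivity) hℓ0.ne', Real.log_mul (by norm_num) (by positivity),
      Real.log_pow]
    push_cast
    ring
  simp only [Real.logb]
  rw [div_le_iff₀ h10]
  have : (Real.log κ / Real.log 10 + 5 * (Real.log n / Real.log 10) + Real.log ℓ / Real.log 10 +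
      1.452) * Real.log 10 = Real.log κ + 5 * Real.log n + Real.log ℓ + 1.452 * Real.log 10 := by
    field_simp
  rw [this]
  linarith

theorem one_le_logb_two {n : ℕ} (hn : 2 ≤ n) : 1 ≤ Real.logb 2 n := by
  have hn' : (2 : ℝ) ≤ n := by exact_mod_cast hn
  rw [Real.le_logb_iff_rpow_le (by norm_num) (by linarith), Real.rpow_one]
  exact hn'

theorem clog_pred_le {n : ℕ} (hn : 2 ≤ n) : (Nat.clog 2 (n - 1) : ℝ) ≤ 1 + Real.logb 2 n := by
  have hℓ := one_le_logb_two hn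
  rcases Nat.lt_or_ge 1 (n - 1) with h | h
  · have h1 := Nat.pow_pred_clog_lt_self (b := 2) (by norm_num) h
    have hpos : 0 < Nat.clog 2 (n - 1) := Nat.clog_pos (by norm_num) h
    have h2 : ((2 : ℝ) ^ ((Nat.clog 2 (n - 1) - 1 : ℕ) : ℝ)) ≤ n := by
      rw [Real.rpow_natCast]
      have : 2 ^ (Nat.clog 2 (n - 1) - 1) ≤ n := by
        rw [Nat.pred_eq_sub_one] at h1
        omega
      exact_mod_cast this
    rw [← Real.le_logb_iff_rpow_le (by norm_num) (by positivity)] at h2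
    rw [Nat.cast_sub hpos, Nat.cast_one] at h2
    linarith
  · rw [Nat.clog_of_right_le_one h]
    push_cast
    linarith

/-- The derivative of the power at `0` is `q`, strictly below `c`. -/
theorem eventually_pow_sub_one_le {q : ℕ} {c : ℝ} (hc : (q : ℝ) < c) :
    ∀ᶠ ε in 𝓝[>] (0 : ℝ), (1 + ε) ^ q - 1 ≤ c * ε := by
  have h : HasDerivAt (fun ε : ℝ => (1 + ε) ^ q) q 0 := by
    have h1 := ((hasDerivAt_id (0 : ℝ)).const_add 1).fun_pow q
    simpa using h1
  have h2 := (hasDerivAt_iff_tendsto_slope.1 h).eventually (gt_mem_nhds hc)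
  have h3 : ∀ᶠ ε in 𝓝[>] (0 : ℝ), slope (fun ε : ℝ => (1 + ε) ^ q) 0 ε < c :=
    h2.filter_mono (nhdsWithin_mono _ fun x hx => (Set.mem_Ioi.1 hx).ne')
  filter_upwards [h3, self_mem_nhdsWithin] with ε h4 h5
  have h5' : 0 < ε := h5
  rw [slope_def_field, div_lt_iff₀ (by linarith)] at h4
  simp only [add_zero, one_pow, sub_zero] at h4
  exact h4.le

theorem tendsto_lossRemainder (n : ℕ) (σ w : ℝ) :
    Tendsto (fun ε : ℝ => lossRemainder n σ w (ε ^ ((6 * n + 3 : ℕ) : ℝ)⁻¹)) (𝓝[>] 0) (𝓝 0) := by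
  have hη : Tendsto (fun ε : ℝ => ε ^ ((6 * n + 3 : ℕ) : ℝ)⁻¹) (𝓝[>] 0) (𝓝 0) := by
    have := (Real.continuous_rpow_const (q := ((6 * n + 3 : ℕ) : ℝ)⁻¹) (by positivity)).tendsto 0
    rw [Real.zero_rpow (by positivity)] at this
    exact this.mono_left nhdsWithin_le_nhds
  have hc : Continuous (lossRemainder n σ w) := by
    unfold lossRemainder
    fun_prop
  have h0 : lossRemainder n σ w 0 = 0 := by simp [lossRemainder]
  have := (hc.tendsto 0).comp hη
  rwa [h0] at this

/-- The negative part is simply discarded; it may have infinite integral. -/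
theorem expectation_le_lintegral {Ω : Type*} [MeasurableSpace Ω] (μ : Measure Ω) (f : Ω → EReal) :
    expectation μ f ≤ ((∫⁻ ω, (f ω).toENNReal ∂μ : ℝ≥0∞) : EReal) := by
  unfold expectation
  exact EReal.sub_le_of_le_add' (le_add_of_nonneg_left (EReal.coe_ennreal_nonneg _))

theorem mainTheorem5 (n : ℕ) (hn : 2 ≤ n) (σ : ℝ) (hσ : 0 < σ) :
    ∃ o : ℝ → ℝ, Tendsto o (𝓝[>] 0) (𝓝 0) ∧
      ∀ᶠ ε in 𝓝[>] (0 : ℝ), ∀ (M : FinitePrecision ε) (T : SummationScheme n)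
        (Lbar : Matrix (Fin n) (Fin n) ℝ) (bbar : Fin n → ℝ),
        (∀ i j, i < j → Lbar i j = 0) → (∀ i j, |Lbar i j| ≤ 1) → (∀ i, |bbar i| ≤ 1) →
        AEMeasurable (fun p => lossOfPrecision M T (Matrix.of p.1) p.2)
            (smoothedTriangular Lbar bbar σ) ∧
          ∫⁻ p, (lossOfPrecision M T (Matrix.of p.1) p.2).toENNReal
            ∂(smoothedTriangular Lbar bbar σ) ≠ ⊤ ∧
          expectation (smoothedTriangular Lbar bbar σ)
              (fun p => lossOfPrecision M T (Matrix.of p.1) p.2) ≤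
            ((Real.logb 10 ((1 + σ) / σ) + 5 * Real.logb 10 n + Real.logb 10 (Real.logb 2 n)
              + 1.452 + o ε : ℝ) : EReal) := by
  have hℓ := one_le_logb_two hn
  set ℓ := Real.logb 2 n
  have hw1 : 1 ≤ 11 * ℓ := by linarith
  -- The choice `w = 11ℓ` works because the exponent is at most `5 + ℓ`, which is less than `11ℓ -
  -- 1` for `ℓ ≥ 1`.
  have hq : ((4 + Nat.clog 2 (n - 1) : ℕ) : ℝ) < 11 * ℓ - 1 := by
    have : (Nat.clog 2 (n - 1) : ℝ) ≤ 1 + ℓ := clog_pred_le hn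
    push_cast
    linarith
  have hlin : Tendsto (fun ε : ℝ => (11 * ℓ - 1) * ε) (𝓝[>] 0) (𝓝 0) := by
    have : Continuous fun ε : ℝ => (11 * ℓ - 1) * ε := by fun_prop
    simpa using (this.tendsto 0).mono_left nhdsWithin_le_nhds
  -- The error term is `lossRemainder` at `η = ε^(1/(6n+3))`, which involves only `n`, `σ` and `ε`.
  refine ⟨_, tendsto_lossRemainder n σ (11 * ℓ), ?_⟩
  filter_upwards [self_mem_nhdsWithin, eventually_pow_sub_one_le hq,
    hlin.eventually (ge_mem_nhds (show (0 : ℝ) < 1 / 2 by norm_num))] with ε hε hpow hhalf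
  intro M T Lbar bbar h0 hL hb
  have hint := lintegral_lossOfPrecision_le hn hσ hε M T h0 hL hb hw1 hpow hhalf rfl
  refine ⟨(measurable_lossOfPrecision M T).aemeasurable,
    (hint.trans_lt ENNReal.ofReal_lt_top).ne, ?_⟩
  refine (expectation_le_lintegral _ _).trans
    ((EReal.coe_ennreal_le_coe_ennreal_iff.2 hint).trans ?_)
  have hbud := log_le_of_budget hn hσ hℓ rfl
  rw [EReal.coe_ennreal_ofReal, EReal.coe_le_coe_iff, max_eq_left]
  · gcongr
  · refine add_nonneg (div_nonneg (mul_nonneg (by norm_num) (Real.log_nonneg ?_))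
      (Real.log_nonneg (by norm_num))) (lossRemainder_nonneg n hσ _ _)
    refine le_add_of_nonneg_right ?_
    positivity
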